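/- Let $\mathrm{sign}(y)=+1$ for $y\ge 0$ and $-1$ for $y<0$, and let $H_d$ be the class of functions $x\mapsto \mathrm{sign}(p(x))$ on $\mathbb{R}$ with $p$ a real polynomial of degree at most $d$. A (randomized, adaptive) label-query learner sees a sample $S$ of $n$ real points, may query the labels $h(x)$ of points $x\in S$ for an unknown hypothesis $h$, and finally outputs a labeling of $S$. Given a distribution $D_H$ on $H_d$, we say that $(U_{[0,1]},D_H,\mathbb{R},H_d)$ is perfectly learnable in $q(n)$ expected queries if there is a learner which, for every $n$, labels every sample of $n$ distinct real points without error under every $h\in H_d$, and which makes at most $q(n)$ queries in expectation over $n$ i.i.d. uniform sample points from $[0,1]$, a hypothesis drawn from $D_H$ (independently of the sample), and the internal randomness of the learner. For $d\ge 1$ and $a\neq 0$, let $D_{a,d}$ be the law of the threshold function of $a\prod_{i=1}^d(x-r_i)$, where the roots $r_1,\dots,r_d$ are i.i.d. uniform on $[0,1]$. **Theorem.** There are absolute constants $c,C,K>0$ such that for all integers $d\ge 1$ and all real $a\ne 0$: 1. (Upper bound.) $(U_{[0,1]},D_{a,d},\mathbb{R},H_d)$ is perfectly learnable in a number $q(n)$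 of expected label queries that satisfies, for all $n\ge 2$, $$q(n)\le C\,d^2\,\log(\max(d,2))\,\log n .$$ 2. (Lower bound.) If $(U_{[0,1]},D_{a,d},\mathbb{R},H_d)$ is perfectly learnable in $q(n)$ expected label queries, then for all $n\ge K d^2$, $$q(n)\ge c\,d\log n .$$ -/

import Mathlib

open MeasureTheory ProbabilityTheory
open scoped NNReal ENNReal

/-- A deterministic adaptive label-query strategy on a sample of `n` points: either stop and output
a labeling of the whole sample, or query the label of the `i`-th point and continue according to the
answer. The label `+1` is `true`, the label `-1` is `false`. -/
inductive QueryTree (n : ℕ) : Type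
  | output (guess : Fin n → Bool) : QueryTree n
  | query (i : Fin n) (next : Bool → QueryTree n) : QueryTree n

namespace QueryTree

/-- The labeling that the strategy outputs when the true labels are `l`. -/
def run {n : ℕ} : QueryTree n → (Fin n → Bool) → (Fin n → Bool)
  | output guess, _ => guess
  | query i next, l => (next (l i)).run l

/-- The number of label queries that the strategy makes when the true labels are `l`. -/
def queries {n : ℕ} : QueryTree n → (Fin n → Bool) → ℕ
  | output _, _ => 0
  | query i next, l => (next (l i)).queries l + 1

instance (n : ℕ) : MeasurableSpace (QueryTree n) := ⊤

end QueryTree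

/-- `(D_X, D_H, X, H)` is perfectly learnable with label queries in `q n` expected queries:
there is a randomized algorithm `A` (seeing the unlabeled sample `S`, it draws a query strategy from
`A n S`) such that, for every `n`, it labels every sample of `n` distinct points without error under
every hypothesis of the class `H`, and its number of queries is at most `q n` in expectation over
`n` independent sample points from `D_X`, a hypothesis from `D_H` and the internal randomness. -/
def PerfectlyLearnable {X : Type*} [MeasurableSpace X] (D_X : Measure X)
    (D_H : Measure (X → Bool)) (H : Set (X → Bool)) (q : ℕ → ℝ≥0) : Prop :=
  ∃ A : (n : ℕ) → Kernel (Fin n → X) (QueryTree n),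
    (∀ n, IsMarkovKernel (A n)) ∧
    (∀ n, ∀ S : Fin n → X, Function.Injective S → ∀ h ∈ H,
      ∀ᵐ t ∂(A n S), t.run (h ∘ S) = h ∘ S) ∧
    (∀ n, ∫⁻ S, ∫⁻ h, ∫⁻ t, (t.queries (h ∘ S) : ℝ≥0∞) ∂(A n S) ∂D_H
        ∂(Measure.pi fun _ : Fin n => D_X) ≤ q n)

/-- The sign of a real number as a label, with the convention `sign 0 = +1`. -/
noncomputable def signLabel (y : ℝ) : Bool := decide (0 ≤ y)

/-- The class `H_d` of univariate polynomial threshold functions of degree at most `d`. -/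
def PTF (d : ℕ) : Set (ℝ → Bool) :=
  {h | ∃ p : Polynomial ℝ, p.natDegree ≤ d ∧ h = fun x => signLabel (p.eval x)}

/-- The uniform distribution on `[0, 1]`, as a distribution on the real line. -/
noncomputable def unif01 : Measure ℝ := volume.restrict (Set.Icc 0 1)

/-- The threshold function of the polynomial with leading coefficient `a` and roots `r`. -/
noncomputable def rootsPTF {d : ℕ} (a : ℝ) (r : Fin d → ℝ) : ℝ → Bool :=
  fun x => signLabel (a * ∏ i, (x - r i))

/-- The law of the threshold function of a polynomial with leading coefficient `a` whose `d` roots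
are independent and uniform on `[0, 1]`. -/
noncomputable def uniformRoots (a : ℝ) (d : ℕ) : Measure (ℝ → Bool) :=
  (Measure.pi fun _ : Fin d => unif01).map (rootsPTF a)

instance : IsProbabilityMeasure unif01 := ⟨by simp [unif01]⟩

lemma rootsPTF_mem_PTF {d : ℕ} (a : ℝ) (r : Fin d → ℝ) : rootsPTF a r ∈ PTF d := by
  refine ⟨Polynomial.C a * ∏ i, (Polynomial.X - Polynomial.C (r i)), ?_, ?_⟩
  · refine (Polynomial.natDegree_C_mul_le _ _).trans ?_
    refine (Polynomial.natDegree_prod_le _ _).trans ?_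
    simp
  · funext x
    simp [rootsPTF, Polynomial.eval_prod]

lemma measurable_signLabel : Measurable signLabel :=
  measurable_to_bool (by
    have : signLabel ⁻¹' {true} = Set.Ici 0 := by
      ext y; simp [signLabel]
    rw [this]; exact measurableSet_Ici)

lemma measurable_rootsPTF {d : ℕ} (a : ℝ) :
    Measurable (rootsPTF a : (Fin d → ℝ) → ℝ → Bool) := by
  refine measurable_pi_lambda _ fun x => measurable_signLabel.comp ?_
  fun_prop

instance (a : ℝ) (d : ℕ) : IsProbabilityMeasure (uniformRoots a d) :=
  Measure.isProbabilityMeasure_map (measurable_rootsPTF a).aemeasurable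

/-!
Both bounds rest on how the sample spreads over the roots: two independent uniform points have fewer
than `s` of `n` uniform sample points between them with probability `O(s / n)`.

Upper bound. Along the sorted sample the labels of a degree `d` threshold function change at most
`d` times. Query the labels at spacings that are halved in each round. Once all `d` changes are
visible, only the midpoints of those `d` gaps are undetermined, and these cost `d` queries per
round. The changes can be hidden at spacing `s` only if two of the roots and the ends of the unit
interval have fewer than `s` sample points between them. This has probability `O(d² s / n)` and
costs at most `O(n / s)` queries, so each of the `O(log n)` rounds costs `O(d²)` in expectation.

Lower bound. A strategy with at most `k` queries is correct on at most `2 ^ k` labelings. If the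
sample meets each of `M` equal cells of the unit interval, a labeling determines roots that have
sample points between them up to order and up to `2 / M`, so it has probability at most
`d! (4 / M) ^ d`. With `M` a power of `n` this forces `k` to be of order `d log n`.
-/

open scoped Finset

/-! ### Changes along a sequence -/

/-- The number of places where the sequence `g` changes its value among its terms `0, …, m`. For
labels along an increasing sequence of points it bounds the number of roots from below. -/
def changes {α : Type*} [DecidableEq α] (g : ℕ → α) (m : ℕ) : ℕ :=
  #{k ∈ Finset.range m | g k ≠ g (k + 1)}

section Changes

variable {α : Type*} [DecidableEq α] {f g : ℕ → α} {d m k : ℕ}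

lemma changes_congr (h : ∀ k ≤ m, f k = g k) : changes f m = changes g m := by
  unfold changes
  congr 1
  refine Finset.filter_congr fun k hk => ?_
  have hkm := Finset.mem_range.1 hk
  rw [h k hkm.le, h (k + 1) hkm]

lemma changes_even_lt_changes (hk : k < m) (heven : f (2 * k) = f (2 * (k + 1)))
    (hodd : f (2 * k + 1) ≠ f (2 * k)) : changes (fun j => f (2 * j)) m < changes f (2 * m) := by
  -- A change over `[2j, 2j + 2]` is witnessed in one of its halves, and `2k` is never used.
  let half j := if f (2 * j) ≠ f (2 * j + 1) then 2 * j else 2 * j + 1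
  have hhalf_inj : Function.Injective half := fun i j hij => by
    simp only [half] at hij
    split_ifs at hij <;> omega
  have hmaps : ({j ∈ Finset.range m | f (2 * j) ≠ f (2 * (j + 1))}).image half ⊆
      ({j ∈ Finset.range (2 * m) | f j ≠ f (j + 1)}).erase (2 * k) := by
    intro i hi
    obtain ⟨j, hj, rfl⟩ := Finset.mem_image.1 hi
    rw [Finset.mem_filter, Finset.mem_range] at hj
    have hjk : j ≠ k := by rintro rfl; exact hj.2 heven
    simp only [Finset.mem_erase, Finset.mem_filter, Finset.mem_range, half]
    split_ifs with h
    · exact ⟨by omega, by omega, h⟩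
    · exact ⟨by omega, by omega, fun h' => hj.2 ((not_not.1 h).trans h')⟩
  have hmem : 2 * k ∈ {j ∈ Finset.range (2 * m) | f j ≠ f (j + 1)} :=
    Finset.mem_filter.2 ⟨Finset.mem_range.2 (by omega), hodd.symm⟩
  calc changes (fun j => f (2 * j)) m
      = #(({j ∈ Finset.range m | f (2 * j) ≠ f (2 * (j + 1))}).image half) :=
        (Finset.card_image_of_injective _ hhalf_inj).symm
    _ ≤ _ := Finset.card_le_card hmaps
    _ < changes f (2 * m) := Finset.card_erase_lt_of_mem hmem

/-- The odd indices whose values are not determined by the values `g k` at the even indices `2 * k`,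
`k ≤ m`, for a sequence with at most `d` changes: all of them if fewer than `d` changes are visible,
and otherwise the midpoints of the visible changes. -/
def undeterminedMidpoints (d : ℕ) (g : ℕ → α) (m : ℕ) : Finset ℕ :=
  ({k ∈ Finset.range m | changes g m < d ∨ g k ≠ g (k + 1)}).image (2 * · + 1)

lemma card_undeterminedMidpoints_le (h : changes g m ≤ d) :
    #(undeterminedMidpoints d g m) ≤ d + if changes g m < d then m else 0 := by
  refine Finset.card_image_le.trans ?_
  split_ifs with hd
  · exact (Finset.card_filter_le _ _).trans (by simp)
  · simp only [hd, false_or, add_zero]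
    exact h

lemma piecewise_undeterminedMidpoints (hg : ∀ k ≤ m, g k = f (2 * k))
    (hf : changes f (2 * m) ≤ d) (hk : k ≤ 2 * m) :
    (undeterminedMidpoints d g m).piecewise f (fun j => g (j / 2)) k = f k := by
  by_cases hmem : k ∈ undeterminedMidpoints d g m
  · exact Finset.piecewise_eq_of_mem _ _ _ hmem
  rw [Finset.piecewise_eq_of_notMem _ _ _ hmem]
  obtain ⟨j, rfl | rfl⟩ := Nat.even_or_odd' k
  · rw [Nat.mul_div_cancel_left j two_pos, hg j (by omega)]
  · have hjm : j < m := by omega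
    have hdet : ¬(changes g m < d ∨ g j ≠ g (j + 1)) := fun h =>
      hmem (Finset.mem_image_of_mem _ (Finset.mem_filter.2 ⟨Finset.mem_range.2 hjm, h⟩))
    push Not at hdet
    rw [show (2 * j + 1) / 2 = j by omega, hg j hjm.le]
    by_contra hodd
    have hlt := changes_even_lt_changes hjm
      ((hg j hjm.le).symm.trans (hdet.2.trans (hg (j + 1) hjm))) (Ne.symm hodd)
    rw [← changes_congr hg] at hlt
    omega

end Changes

/-! ### Query strategies -/

namespace QueryTree

variable {n d m J : ℕ} {idx : ℕ → Fin n} {pos : Fin n → ℕ} {l : Fin n → Bool}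

lemma card_run_eq_le (t : QueryTree n) (k : ℕ) :
    #{l : Fin n → Bool | t.run l = l ∧ t.queries l ≤ k} ≤ 2 ^ k := by
  induction t generalizing k with
  | output guess =>
    refine (Finset.card_le_one.2 fun l hl l' hl' => ?_).trans Nat.one_le_two_pow
    exact (Finset.mem_filter.1 hl).2.1.symm.trans (Finset.mem_filter.1 hl').2.1
  | query i next ih =>
    cases k with
    | zero => simp [queries]
    | succ k =>
      have hsub : ({l | (query i next).run l = l ∧ (query i next).queries l ≤ k + 1} :
          Finset (Fin n → Bool)) ⊆
          Finset.univ.biUnion fun b => {l | (next b).run l = l ∧ (next b).queries l ≤ k} := by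
        intro l hl
        simp only [Finset.mem_filter, Finset.mem_univ, true_and, run, queries,
          Nat.add_le_add_iff_right] at hl
        simpa only [Finset.mem_biUnion, Finset.mem_filter, Finset.mem_univ, true_and] using
          ⟨l i, hl⟩
      calc _ ≤ _ := (Finset.card_le_card hsub).trans Finset.card_biUnion_le
        _ ≤ ∑ _b : Bool, 2 ^ k := Finset.sum_le_sum fun b _ => ih b k
        _ = 2 ^ (k + 1) := by simp [pow_succ']

/-- The strategy that queries the points `idx k` for the `k` in a list, writes the answers into the
table `g`, and continues with the updated table. -/
def queryList (idx : ℕ → Fin n) :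
    List ℕ → (ℕ → Bool) → ((ℕ → Bool) → QueryTree n) → QueryTree n
  | [], g, c => c g
  | k :: L, g, c => query (idx k) fun b => queryList idx L (Function.update g k b) c

lemma piecewise_update_toFinset (L : List ℕ) (f g : ℕ → Bool) (k : ℕ) :
    L.toFinset.piecewise f (Function.update g k (f k)) = (k :: L).toFinset.piecewise f g := by
  rw [List.toFinset_cons, Finset.piecewise_insert, Finset.update_piecewise, Function.update_eq_self]

lemma run_queryList (L : List ℕ) (g : ℕ → Bool) (c : (ℕ → Bool) → QueryTree n) :
    (queryList idx L g c).run l = (c (L.toFinset.piecewise (l ∘ idx) g)).run l := by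
  induction L generalizing g with
  | nil => rw [queryList, List.toFinset_nil, Finset.piecewise_empty]
  | cons k L ih => rw [queryList, run, ih, ← piecewise_update_toFinset, Function.comp_apply]

lemma queries_queryList (L : List ℕ) (g : ℕ → Bool) (c : (ℕ → Bool) → QueryTree n) :
    (queryList idx L g c).queries l =
      L.length + (c (L.toFinset.piecewise (l ∘ idx) g)).queries l := by
  induction L generalizing g with
  | nil =>
    rw [queryList, List.toFinset_nil, Finset.piecewise_empty, List.length_nil, zero_add]
  | cons k L ih =>
    rw [queryList, queries, ih, ← piecewise_update_toFinset, Function.comp_apply, List.length_cons,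
      add_right_comm]

/-- Dyadic refinement for labels with at most `d` changes. The points are arranged along the
positions `k : ℕ` by `idx`, with `pos` a right inverse; the table `g` holds the labels at the
positions `k * 2 ^ e`, `k ≤ m`, and each of the `e` rounds halves the spacing. The labels of the
midpoints that are not queried are copied from their left neighbors. -/
def refine (d : ℕ) (idx : ℕ → Fin n) (pos : Fin n → ℕ) :
    ℕ → ℕ → (ℕ → Bool) → QueryTree n
  | 0, _, g => output fun i => g (pos i)
  | e + 1, m, g =>
    queryList (fun k => idx (k * 2 ^ e)) (undeterminedMidpoints d g m).sort (fun k => g (k / 2))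
      fun g' => refine d idx pos e (2 * m) g'

lemma refine_table_eq {e : ℕ} {g : ℕ → Bool} (hg : ∀ k ≤ m, g k = l (idx (k * 2 ^ (e + 1))))
    (hc : ∀ s k, changes (fun j => l (idx (j * s))) k ≤ d) (k : ℕ) (hk : k ≤ 2 * m) :
    (undeterminedMidpoints d g m).sort.toFinset.piecewise (l ∘ fun k => idx (k * 2 ^ e))
      (fun k => g (k / 2)) k = l (idx (k * 2 ^ e)) := by
  rw [Finset.sort_toFinset]
  refine piecewise_undeterminedMidpoints (fun j hj => ?_) (hc _ _) hk
  rw [hg j hj, Function.comp_apply, pow_succ', ← mul_assoc, mul_comm j 2]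

lemma run_refine (hpos : ∀ i, idx (pos i) = i)
    (hc : ∀ s k, changes (fun j => l (idx (j * s))) k ≤ d) (e m : ℕ)
    (hm : ∀ i, pos i ≤ m * 2 ^ e) (g : ℕ → Bool) (hg : ∀ k ≤ m, g k = l (idx (k * 2 ^ e))) :
    (refine d idx pos e m g).run l = l := by
  induction e generalizing m g with
  | zero =>
    funext i
    rw [refine, run, hg _ (by simpa using hm i), pow_zero, mul_one, hpos]
  | succ e ih =>
    rw [refine, run_queryList]
    exact ih (2 * m) (fun i => (hm i).trans_eq (by ring)) _ (refine_table_eq hg hc)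

lemma queries_refine_le (hc : ∀ s k, changes (fun j => l (idx (j * s))) k ≤ d) (e m : ℕ)
    (g : ℕ → Bool) (hg : ∀ k ≤ m, g k = l (idx (k * 2 ^ e))) :
    (refine d idx pos e m g).queries l ≤ ∑ j ∈ Finset.range e, (d +
      if changes (fun k => l (idx (k * 2 ^ (e - j)))) (m * 2 ^ j) < d then m * 2 ^ j else 0) := by
  induction e generalizing m g with
  | zero => simp [refine, queries]
  | succ e ih =>
    rw [refine, queries_queryList, Finset.sum_range_succ', add_comm, Finset.length_sort]
    have hg_changes := changes_congr hg
    gcongr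
    · refine (ih (2 * m) _ (refine_table_eq hg hc)).trans_eq (Finset.sum_congr rfl fun j _ => ?_)
      rw [Nat.add_sub_add_right, mul_comm 2 m, mul_assoc, ← pow_succ']
    · refine (card_undeterminedMidpoints_le (hg_changes.trans_le (hc _ _))).trans_eq ?_
      simp [hg_changes]

/-- Dyadic refinement of the positions `0, …, 2 ^ J`, started from the queries of the two ends. -/
def dyadic (d : ℕ) (idx : ℕ → Fin n) (pos : Fin n → ℕ) (J : ℕ) : QueryTree n :=
  queryList (fun k => idx (k * 2 ^ J)) [0, 1] (fun _ => true) (refine d idx pos J 1)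

lemma dyadic_table_eq (f g : ℕ → Bool) (k : ℕ) (hk : k ≤ 1) :
    [0, 1].toFinset.piecewise f g k = f k :=
  Finset.piecewise_eq_of_mem _ _ _ (by simp; omega)

lemma run_dyadic (hpos : ∀ i, idx (pos i) = i) (hJ : ∀ i, pos i ≤ 2 ^ J)
    (hc : ∀ s k, changes (fun j => l (idx (j * s))) k ≤ d) :
    (dyadic d idx pos J).run l = l := by
  rw [dyadic, run_queryList]
  exact run_refine hpos hc _ _ (by simpa using hJ) _ (dyadic_table_eq _ _)

lemma queries_dyadic_le (hc : ∀ s k, changes (fun j => l (idx (j * s))) k ≤ d) :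
    (dyadic d idx pos J).queries l ≤ 2 + ∑ j ∈ Finset.range J, (d +
      if changes (fun k => l (idx (k * 2 ^ (J - j)))) (2 ^ j) < d then 2 ^ j else 0) := by
  rw [dyadic, queries_queryList]
  gcongr
  · simp
  · simpa only [one_mul, Function.comp_def] using
      queries_refine_le hc J 1 _ (dyadic_table_eq _ _)

end QueryTree

/-! ### Sign changes of polynomials -/

section Signs

variable {u v : ℝ}

lemma signLabel_eq_signLabel_iff (hu : u ≠ 0) (hv : v ≠ 0) :
    signLabel u = signLabel v ↔ 0 < u * v := by
  rw [signLabel, signLabel, decide_eq_decide, mul_pos_iff]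
  grind

lemma exists_forall_add_ne_zero_and_signLabel_eq (T : Finset ℝ) :
    ∃ ε, ∀ y ∈ T, y + ε ≠ 0 ∧ signLabel (y + ε) = signLabel y := by
  have h : ∀ᶠ ε in nhdsWithin (0 : ℝ) (Set.Ioi 0),
      ∀ y ∈ T, y + ε ≠ 0 ∧ signLabel (y + ε) = signLabel y := by
    rw [Filter.eventually_all_finset]
    intro y _
    simp only [signLabel, decide_eq_decide]
    rcases le_or_gt 0 y with hy | hy
    · filter_upwards [self_mem_nhdsWithin] with ε hε
      have hpos := add_pos_of_nonneg_of_pos hy hε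
      exact ⟨hpos.ne', iff_of_true hpos.le hy⟩
    · filter_upwards [Ioo_mem_nhdsGT (neg_pos.2 hy)] with ε hε
      have hneg : y + ε < 0 := by linarith [hε.2]
      exact ⟨hneg.ne, iff_of_false hneg.not_ge hy.not_ge⟩
  exact h.exists

lemma exists_mem_Ioo_eq_zero {f : ℝ → ℝ} (hf : Continuous f) (huv : u ≤ v) (hu : f u ≠ 0)
    (hv : f v ≠ 0) (hne : signLabel (f u) ≠ signLabel (f v)) : ∃ y ∈ Set.Ioo u v, f y = 0 := by
  rw [Ne, signLabel_eq_signLabel_iff hu hv, not_lt, mul_nonpos_iff] at hne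
  rcases hne with ⟨h, h'⟩ | ⟨h, h'⟩
  · exact intermediate_value_Ioo' huv hf.continuousOn ⟨h'.lt_of_ne hv, h.lt_of_ne' hu⟩
  · exact intermediate_value_Ioo huv hf.continuousOn ⟨h.lt_of_ne hu, h'.lt_of_ne' hv⟩

lemma changes_signLabel_le_card {f : ℝ → ℝ} (hf : Continuous f) {Z : Finset ℝ}
    (hZ : ∀ y, f y = 0 → y ∈ Z) {x : ℕ → ℝ} (hx : Monotone x) {m : ℕ}
    (hne : ∀ k ≤ m, f (x k) ≠ 0) : changes (fun k => signLabel (f (x k))) m ≤ #Z := by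
  have hzero : ∀ k ∈ {k ∈ Finset.range m | signLabel (f (x k)) ≠ signLabel (f (x (k + 1)))},
      ∃ y ∈ Set.Ioo (x k) (x (k + 1)), f y = 0 := by
    intro k hk
    rw [Finset.mem_filter, Finset.mem_range] at hk
    exact exists_mem_Ioo_eq_zero hf (hx k.le_succ) (hne _ hk.1.le) (hne _ hk.1) hk.2
  choose! y hy hfy using hzero
  refine Finset.card_le_card_of_injOn y (fun k hk => hZ _ (hfy k hk)) ?_
  intro j hj k hk hjk
  by_contra h
  exact Set.disjoint_left.1 (hx.pairwise_disjoint_on_Ioo_succ h) (hy j hj) (hjk ▸ hy k hk)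

lemma changes_le_of_mem_PTF {d : ℕ} {h : ℝ → Bool} (hh : h ∈ PTF d) {x : ℕ → ℝ}
    (hx : Monotone x) (m : ℕ) : changes (fun k => h (x k)) m ≤ d := by
  obtain ⟨p, hp, rfl⟩ := hh
  -- After a small positive shift of `p`, no point of the sequence is a root.
  obtain ⟨ε, hε⟩ := exists_forall_add_ne_zero_and_signLabel_eq
    ((Finset.range (m + 1)).image fun k => p.eval (x k))
  replace hε k (hk : k ≤ m) := hε _ (Finset.mem_image_of_mem _ (Finset.mem_range_succ_iff.2 hk))
  set P := p + Polynomial.C ε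
  have heval y : P.eval y = p.eval y + ε := by rw [Polynomial.eval_add, Polynomial.eval_C]
  have hP0 : P ≠ 0 := by
    intro h0
    apply (hε 0 m.zero_le).1
    rw [← heval, h0, Polynomial.eval_zero]
  calc changes (fun k => signLabel (p.eval (x k))) m
      = changes (fun k => signLabel (P.eval (x k))) m :=
        changes_congr fun k hk => by rw [heval, (hε k hk).2]
    _ ≤ #P.roots.toFinset := changes_signLabel_le_card P.continuous
        (fun y hy => Multiset.mem_toFinset.2 ((Polynomial.mem_roots hP0).2 hy)) hx
        fun k hk => heval _ ▸ (hε k hk).1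
    _ ≤ P.natDegree := P.roots.toFinset_card_le.trans P.card_roots'
    _ ≤ d := by rwa [Polynomial.natDegree_add_C]

variable {d : ℕ} {a : ℝ} {r : Fin d → ℝ}

lemma rootsPTF_eq_iff (ha : a ≠ 0) (hu : ∀ i, r i ≠ u) (hv : ∀ i, r i ≠ v) :
    rootsPTF a r u = rootsPTF a r v ↔ 0 < ∏ i, (u - r i) * (v - r i) := by
  rw [rootsPTF, rootsPTF, signLabel_eq_signLabel_iff, mul_mul_mul_comm, ← Finset.prod_mul_distrib,
    mul_pos_iff_of_pos_left (mul_self_pos.2 ha)]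
  · exact mul_ne_zero ha (Finset.prod_ne_zero_iff.2 fun i _ => sub_ne_zero.2 (hu i).symm)
  · exact mul_ne_zero ha (Finset.prod_ne_zero_iff.2 fun i _ => sub_ne_zero.2 (hv i).symm)

lemma sub_mul_sub_pos_of_notMem_Icc {x : ℝ} (hx : x ∉ Set.Icc u v) (huv : u ≤ v) :
    0 < (u - x) * (v - x) := by
  rcases lt_or_ge x u with h | h
  · exact mul_pos (sub_pos.2 h) (sub_pos.2 (h.trans_le huv))
  · have hvx : v < x := not_le.1 fun h' => hx ⟨h, h'⟩
    exact mul_pos_of_neg_of_neg (sub_neg.2 (huv.trans_lt hvx)) (sub_neg.2 hvx)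

lemma rootsPTF_eq_of_forall_notMem_Icc (ha : a ≠ 0) (huv : u ≤ v)
    (hr : ∀ i, r i ∉ Set.Icc u v) : rootsPTF a r u = rootsPTF a r v :=
  (rootsPTF_eq_iff ha (fun i => (ne_of_mem_of_not_mem (Set.left_mem_Icc.2 huv) (hr i)).symm)
    fun i => (ne_of_mem_of_not_mem (Set.right_mem_Icc.2 huv) (hr i)).symm).2 <|
    Finset.prod_pos fun i _ => sub_mul_sub_pos_of_notMem_Icc (hr i) huv

lemma rootsPTF_ne_of_unique_mem_Icc (ha : a ≠ 0) {i : Fin d} (hi : r i ∈ Set.Ioo u v)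
    (hunique : ∀ j, r j ∈ Set.Icc u v → j = i) : rootsPTF a r u ≠ rootsPTF a r v := by
  have huv := (hi.1.trans hi.2).le
  rw [Ne, rootsPTF_eq_iff ha, ← Finset.mul_prod_erase _ _ (Finset.mem_univ i), not_lt]
  · refine mul_nonpos_of_nonpos_of_nonneg ?_ (Finset.prod_nonneg fun j hj => ?_)
    · exact (mul_neg_of_neg_of_pos (sub_neg.2 hi.1) (sub_pos.2 hi.2)).le
    · exact (sub_mul_sub_pos_of_notMem_Icc
        (fun h => Finset.ne_of_mem_erase hj (hunique j h)) huv).le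
  · rintro j rfl
    exact hi.1.ne' (hunique j (Set.left_mem_Icc.2 huv) ▸ rfl)
  · rintro j rfl
    exact hi.2.ne (hunique j (Set.right_mem_Icc.2 huv) ▸ rfl)

lemma le_changes_rootsPTF (ha : a ≠ 0) {x : ℕ → ℝ} (hx : Monotone x) {m : ℕ}
    (hne : ∀ i k, r i ≠ x k) (h0 : ∀ i, x 0 < r i) (hm : ∀ i, r i < x m)
    (hsep : ∀ i j k, r i ∈ Set.Icc (x k) (x (k + 1)) → r j ∈ Set.Icc (x k) (x (k + 1)) → i = j) :
    d ≤ changes (fun k => rootsPTF a r (x k)) m := by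
  have hgap i : ∃ k, r i ∈ Set.Ioo (x k) (x (k + 1)) := by
    obtain ⟨k, hk, hk'⟩ := Nat.exists_not_and_succ_of_not_zero_of_exists
      (p := fun k => r i < x k) (h0 i).not_gt ⟨m, hm i⟩
    exact ⟨k, (not_lt.1 hk).lt_of_ne' (hne i k), hk'⟩
  choose k hk using hgap
  have hk_inj : Function.Injective k := fun i j hij =>
    hsep i j (k i) (Set.Ioo_subset_Icc_self (hk i)) (hij ▸ Set.Ioo_subset_Icc_self (hk j))
  have hmem i : k i ∈ ({j ∈ Finset.range m | rootsPTF a r (x j) ≠ rootsPTF a r (x (j + 1))}) :=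
    Finset.mem_filter.2 ⟨Finset.mem_range.2 (hx.reflect_lt ((hk i).1.trans (hm i))),
      rootsPTF_ne_of_unique_mem_Icc ha (hk i) fun j hj =>
        hsep j i (k i) hj (Set.Ioo_subset_Icc_self (hk i))⟩
  calc d = #(Finset.univ : Finset (Fin d)) := (Finset.card_fin d).symm
    _ ≤ _ := Finset.card_le_card_of_injOn k (fun i _ => hmem i) hk_inj.injOn

end Signs

/-! ### Roots and the gaps of a sample -/

section Gaps

open Classical in
/-- The number of sample points strictly between `u` and `v`, which may come in either order. -/
noncomputable def between {ι : Type*} [Fintype ι] (S : ι → ℝ) (u v : ℝ) : ℕ :=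
  #{i | S i ∈ Set.uIoo u v}

/-- The sample has at least `s` points between any two roots, and between each root and either end
of the unit interval. -/
def Separates {ι κ : Type*} [Fintype ι] (s : ℕ) (S : ι → ℝ) (r : κ → ℝ) : Prop :=
  (∀ i j, i ≠ j → s ≤ between S (r i) (r j)) ∧
    ∀ i, s ≤ between S 0 (r i) ∧ s ≤ between S 1 (r i)

/-- Every one of the `M` equal cells of the unit interval contains a sample point. -/
def HitsCells {ι : Type*} (M : ℕ) (S : ι → ℝ) : Prop :=
  ∀ c < M, ∃ i, S i ∈ Set.Ioo ((c : ℝ) / M) ((c + 1) / M)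

variable {ι : Type*}

lemma one_le_between [Fintype ι] {S : ι → ℝ} {u v : ℝ} :
    1 ≤ between S u v ↔ ∃ i, S i ∈ Set.uIoo u v := by
  classical
  rw [between, Finset.one_le_card, Finset.filter_nonempty_iff]
  simp only [Finset.mem_univ, true_and]

lemma exists_Ioo_mem_of_exists_lt_of_exists_gt [Finite ι] {S : ι → ℝ} {x : ℝ} (hx : ∀ i, x ≠ S i)
    (hlt : ∃ i, S i < x) (hgt : ∃ i, x < S i) :
    ∃ j k, x ∈ Set.Ioo (S j) (S k) ∧ ∀ i, S i ∉ Set.Ioo (S j) (S k) := by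
  obtain ⟨j, hj, hj_max⟩ := Set.exists_max_image {i | S i < x} S (Set.toFinite _) hlt
  obtain ⟨k, hk, hk_min⟩ := Set.exists_min_image {i | x < S i} S (Set.toFinite _) hgt
  refine ⟨j, k, ⟨hj, hk⟩, fun i hi => ?_⟩
  rcases (hx i).lt_or_gt with h | h
  · exact (hk_min i h).not_gt hi.2
  · exact (hj_max i h).not_gt hi.1

lemma exists_root_same_gap [Fintype ι] {d : ℕ} {a : ℝ} (ha : a ≠ 0) {S : ι → ℝ} {r r' : Fin d → ℝ}
    (hr01 : ∀ l, r l ∈ Set.Ioo (0 : ℝ) 1) (hr : ∀ l i, r l ≠ S i) (hsep : Separates 1 S r)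
    (hlabel : rootsPTF a r ∘ S = rootsPTF a r' ∘ S) (l : Fin d) :
    ∃ l', ∀ i, S i ∉ Set.uIoo (r l) (r' l') := by
  obtain ⟨i₀, hi₀⟩ := one_le_between.1 (hsep.2 l).1
  obtain ⟨i₁, hi₁⟩ := one_le_between.1 (hsep.2 l).2
  rw [Set.uIoo_of_le (hr01 l).1.le] at hi₀
  rw [Set.uIoo_of_ge (hr01 l).2.le] at hi₁
  obtain ⟨j, k, hl, hgap⟩ :=
    exists_Ioo_mem_of_exists_lt_of_exists_gt (hr l) ⟨i₀, hi₀.2⟩ ⟨i₁, hi₁.1⟩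
  have hno {u v} (hu : u ∈ Set.Icc (S j) (S k)) (hv : v ∈ Set.Icc (S j) (S k)) i :
      S i ∉ Set.uIoo u v := fun hi =>
    hgap i ⟨(le_inf hu.1 hv.1).trans_lt hi.1, hi.2.trans_le (sup_le hu.2 hv.2)⟩
  have hunique : ∀ m, r m ∈ Set.Icc (S j) (S k) → m = l := by
    intro m hm
    by_contra hne
    obtain ⟨i, hi⟩ := one_le_between.1 (hsep.1 m l hne)
    exact hno hm (Set.Ioo_subset_Icc_self hl) i hi
  -- The label changes across the gap around `r l`, so the other polynomial has a root there.
  have hne : rootsPTF a r' (S j) ≠ rootsPTF a r' (S k) := fun h =>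
    rootsPTF_ne_of_unique_mem_Icc ha hl hunique <|
      (congrFun hlabel j).trans (h.trans (congrFun hlabel k).symm)
  obtain ⟨l', hl'⟩ : ∃ l', r' l' ∈ Set.Icc (S j) (S k) := by
    by_contra! h
    exact hne (rootsPTF_eq_of_forall_notMem_Icc ha (hl.1.trans hl.2).le h)
  exact ⟨l', hno (Set.Ioo_subset_Icc_self hl) hl'⟩

lemma abs_sub_le_of_hitsCells {M : ℕ} (hM : 0 < M) {S : ι → ℝ} (hS : HitsCells M S) {u v : ℝ}
    (hu : u ∈ Set.Icc (0 : ℝ) 1) (hv : v ∈ Set.Icc (0 : ℝ) 1)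
    (huv : ∀ i, S i ∉ Set.uIoo u v) : |u - v| ≤ 2 / M := by
  have hM' : (0 : ℝ) < M := Nat.cast_pos.2 hM
  wlog h : u ≤ v generalizing u v
  · rw [abs_sub_comm]
    exact this hv hu (fun i => Set.uIoo_comm u v ▸ huv i) (le_of_not_ge h)
  rw [abs_of_nonpos (sub_nonpos.2 h), neg_sub]
  by_contra! hlong
  rw [div_lt_iff₀ hM'] at hlong
  -- An interval longer than two cells contains the cell after the one of its left end.
  obtain ⟨c, hc⟩ : ∃ c, ⌊u * M⌋₊ + 1 = c := ⟨_, rfl⟩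
  have hleft : u * M < c := by simpa [← hc] using Nat.lt_floor_add_one (u * M)
  have hright : (c : ℝ) + 1 < v * M := by
    have := Nat.floor_le (mul_nonneg hu.1 hM'.le)
    rw [← hc]
    push_cast
    linarith
  have hcM : c < M := by
    have : (c : ℝ) < M := by nlinarith [hv.2]
    exact_mod_cast this
  obtain ⟨i, hi⟩ := hS c hcM
  refine huv i (Set.uIoo_of_le h ▸ ⟨?_, ?_⟩)
  · exact ((lt_div_iff₀ hM').2 hleft).trans hi.1
  · exact hi.2.trans ((div_lt_iff₀ hM').2 hright)

lemma exists_perm_abs_sub_le [Fintype ι] {d M : ℕ} {a : ℝ} (ha : a ≠ 0) (hM : 0 < M) {S : ι → ℝ}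
    (hS : HitsCells M S) {r r' : Fin d → ℝ} (hr01 : ∀ l, r l ∈ Set.Ioo (0 : ℝ) 1)
    (hr01' : ∀ l, r' l ∈ Set.Ioo (0 : ℝ) 1) (hr : ∀ l i, r l ≠ S i) (hr' : ∀ l i, r' l ≠ S i)
    (hsep : Separates 1 S r) (hlabel : rootsPTF a r ∘ S = rootsPTF a r' ∘ S) :
    ∃ σ : Equiv.Perm (Fin d), ∀ l, |r l - r' (σ l)| ≤ 2 / M := by
  choose σ hσ using exists_root_same_gap ha hr01 hr hsep hlabel
  have hσ_inj : Function.Injective σ := by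
    intro l m hlm
    by_contra hne
    obtain ⟨i, hi⟩ := one_le_between.1 (hsep.1 l m hne)
    have hl := hσ l i
    have hm := hσ m i
    rw [← hlm] at hm
    have := hr' (σ l) i
    simp only [Set.uIoo, Set.mem_Ioo, inf_lt_iff, lt_sup_iff] at hi hl hm
    grind
  exact ⟨Equiv.ofBijective σ (Finite.injective_iff_bijective.1 hσ_inj), fun l =>
    abs_sub_le_of_hitsCells hM hS (Set.Ioo_subset_Icc_self (hr01 l))
      (Set.Ioo_subset_Icc_self (hr01' _)) (hσ l)⟩

end Gaps

/-! ### Uniform samples and uniform roots -/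

lemma half_le_one_sub_one_div_pow {s : ℕ} (hs : s ≠ 0) : (1 / 2 : ℝ) ≤ (1 - 1 / (2 * s)) ^ s := by
  have hs' : (1 : ℝ) ≤ s := Nat.one_le_cast.2 (Nat.one_le_iff_ne_zero.2 hs)
  have hsmall : (1 : ℝ) / (2 * s) ≤ 1 := (div_le_one (by positivity)).2 (by linarith)
  have hbernoulli := one_add_mul_le_pow (a := -(1 / (2 * (s : ℝ)))) (by linarith) s
  rw [← sub_eq_add_neg] at hbernoulli
  refine le_trans (le_of_eq ?_) hbernoulli
  field_simp
  norm_num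

section Product

variable {ι α : Type*} [Fintype ι] [MeasurableSpace α] {μ : Measure α} [IsProbabilityMeasure μ]
  {A : Set α} {s : ℕ}

lemma integral_pow_card_mem [DecidablePred (· ∈ A)] (hA : MeasurableSet A) (t : ℝ) :
    ∫ S : ι → α, t ^ #{i | S i ∈ A} ∂Measure.pi (fun _ => μ) =
      (1 - (1 - t) * μ.real A) ^ Fintype.card ι := by
  have hprod (S : ι → α) : t ^ #{i | S i ∈ A} = ∏ i, (1 - A.indicator (fun _ => 1 - t) (S i)) := by
    rw [← Finset.prod_const, Finset.prod_filter]
    exact Finset.prod_congr rfl fun i _ => by by_cases h : S i ∈ A <;> simp [h]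
  have hsingle : ∫ x, (1 - A.indicator (fun _ => 1 - t) x) ∂μ = 1 - (1 - t) * μ.real A := by
    rw [integral_sub (integrable_const _) ((integrable_const _).indicator hA),
      integral_indicator_const _ hA]
    simp [mul_comm]
  simp_rw [hprod]
  rw [integral_fintype_prod_eq_pow (fun x => 1 - A.indicator (fun _ => 1 - t) x), hsingle]

/-- Markov's inequality for `t ^ #{i | S i ∈ A}` with `t = 1 - 1 / (2 * s)`, which is at least
`1 / 2` as soon as the exponent is at most `s`. -/
lemma measure_pi_card_mem_lt_le [DecidablePred (· ∈ A)] (hA : MeasurableSet A) (hs : s ≠ 0) :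
    Measure.pi (fun _ => μ) {S : ι → α | #{i | S i ∈ A} < s} ≤
      ENNReal.ofReal (2 * (1 - μ.real A / (2 * s)) ^ Fintype.card ι) := by
  set t : ℝ := 1 - 1 / (2 * s) with ht
  have ht1 : t ≤ 1 := sub_le_self _ (by positivity)
  have ht0 : 0 ≤ t := sub_nonneg.2 <| (div_le_one (by positivity)).2 <| by
    have : (1 : ℝ) ≤ s := Nat.one_le_cast.2 (Nat.one_le_iff_ne_zero.2 hs)
    linarith
  have hmeas : Measurable fun S : ι → α => t ^ #{i | S i ∈ A} := by
    simp_rw [Finset.card_filter]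
    exact measurable_const.pow <| Finset.measurable_fun_sum _ fun i _ =>
      .ite (measurable_pi_apply i hA) measurable_const measurable_const
  have hmarkov := mul_meas_ge_le_integral_of_nonneg (μ := Measure.pi fun _ : ι => μ)
    (.of_forall fun S => pow_nonneg ht0 #{i | S i ∈ A})
    (.of_bound (C := 1) hmeas.aestronglyMeasurable <| .of_forall fun S => by
      rw [Real.norm_of_nonneg (pow_nonneg ht0 _)]
      exact pow_le_one₀ ht0 ht1) (1 / 2)
  have hmono : (Measure.pi fun _ => μ).real {S : ι → α | #{i | S i ∈ A} < s} ≤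
      (Measure.pi fun _ => μ).real {S : ι → α | 1 / 2 ≤ t ^ #{i | S i ∈ A}} :=
    measureReal_mono fun S (hS : #{i | S i ∈ A} < s) =>
      (half_le_one_sub_one_div_pow hs).trans (pow_le_pow_of_le_one ht0 ht1 hS.le)
  rw [integral_pow_card_mem hA, ht, sub_sub_cancel, ← ht] at hmarkov
  rw [← ofReal_measureReal, div_eq_mul_one_div, mul_comm (μ.real A)]
  exact ENNReal.ofReal_le_ofReal (by linarith)

lemma measurePreserving_eval_pair {i j : ι} (hij : i ≠ j) :
    MeasurePreserving (fun S : ι → α => (S i, S j)) (Measure.pi fun _ => μ) (μ.prod μ) := by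
  have hindep := (iIndepFun_pi (μ := fun _ : ι => μ) (X := fun _ => id)
    fun _ => aemeasurable_id).indepFun hij
  refine ⟨by fun_prop, ((indepFun_iff_map_prod_eq_prod_map_map
    (measurable_pi_apply i).aemeasurable (measurable_pi_apply j).aemeasurable).1 hindep).trans ?_⟩
  exact congrArg₂ Measure.prod (measurePreserving_eval (fun _ => μ) i).map_eq
    (measurePreserving_eval (fun _ => μ) j).map_eq

lemma ae_injective_pi [MeasurableEq α] [NullSingletonClass μ] :
    ∀ᵐ S ∂Measure.pi (fun _ : ι => μ), Function.Injective S := by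
  have hdiag : ∀ᵐ p ∂μ.prod μ, p.1 ≠ p.2 :=
    (Measure.ae_prod_iff_ae_ae measurableSet_diagonal.compl).2 <| .of_forall fun x => by
      filter_upwards [measure_eq_zero_iff_ae_notMem.1 (measure_singleton x)] with y hy
      exact fun h => hy h.symm
  have hpair i j : ∀ᵐ S ∂Measure.pi (fun _ : ι => μ), i ≠ j → S i ≠ S j :=
    Filter.eventually_all.2 fun hij =>
      (measurePreserving_eval_pair hij).quasiMeasurePreserving.ae hdiag
  filter_upwards [ae_all_iff.2 fun i => ae_all_iff.2 (hpair i)] with S hS i j hij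
  by_contra hne
  exact hS i j hne hij

end Product

lemma ae_unif01_mem_Icc : ∀ᵐ x ∂unif01, x ∈ Set.Icc (0 : ℝ) 1 := ae_restrict_mem measurableSet_Icc

instance : NullSingletonClass unif01 := by unfold unif01; infer_instance

lemma unif01_real_uIoo {u v : ℝ} (hu : u ∈ Set.Icc (0 : ℝ) 1) (hv : v ∈ Set.Icc (0 : ℝ) 1) :
    unif01.real (Set.uIoo u v) = |u - v| := by
  have hsub : Set.Ioo (u ⊓ v) (u ⊔ v) ⊆ Set.Icc 0 1 := fun x hx =>
    ⟨(le_inf hu.1 hv.1).trans hx.1.le, hx.2.le.trans (sup_le hu.2 hv.2)⟩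
  rw [unif01, Set.uIoo, measureReal_restrict_apply measurableSet_Ioo, Set.inter_eq_left.2 hsub,
    Real.volume_real_Ioo_of_le inf_le_sup, max_sub_min_eq_abs']

lemma lintegral_unif01_comp_abs_sub_le {x : ℝ} (hx : x ∈ Set.Icc (0 : ℝ) 1) (f : ℝ → ℝ≥0∞) :
    ∫⁻ y, f |x - y| ∂unif01 ≤ 2 * ∫⁻ y, f y ∂unif01 := by
  have hneg : ∫⁻ y in Set.Icc (-1) 0, f |y| = ∫⁻ y in Set.Icc 0 1, f |y| := by
    rw [← (Measure.measurePreserving_neg volume).setLIntegral_comp_preimage_emb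
      (Homeomorph.neg ℝ).measurableEmbedding]
    simp
  calc ∫⁻ y, f |x - y| ∂unif01 = ∫⁻ y in Set.Icc (x - 1) x, f |y| := by
        rw [← (Measure.measurePreserving_sub_left volume x).setLIntegral_comp_preimage_emb
          (Homeomorph.subLeft x).measurableEmbedding, Set.preimage_const_sub_Icc, sub_self,
          sub_sub_cancel, unif01]
    _ ≤ ∫⁻ y in Set.Icc (-1) 0 ∪ Set.Icc 0 1, f |y| := by
        refine lintegral_mono_set ?_
        rw [Set.Icc_union_Icc_eq_Icc (by norm_num) zero_le_one]
        exact Set.Icc_subset_Icc (by linarith [hx.1]) hx.2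
    _ ≤ _ := lintegral_union_le _ _ _
    _ = 2 * ∫⁻ y in Set.Icc 0 1, f |y| := by rw [hneg, two_mul]
    _ = 2 * ∫⁻ y, f y ∂unif01 := by
        rw [unif01]
        congr 1
        exact setLIntegral_congr_fun measurableSet_Icc fun y hy => congrArg f (abs_of_nonneg hy.1)

lemma lintegral_unif01_one_sub_mul_pow_le {c : ℝ} (hc0 : 0 < c) (hc1 : c ≤ 1) (n : ℕ) :
    ∫⁻ y, ENNReal.ofReal ((1 - c * y) ^ n) ∂unif01 ≤ ENNReal.ofReal (1 / (c * (n + 1))) := by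
  have hcont : Continuous fun y : ℝ => (1 - c * y) ^ n := by fun_prop
  rw [unif01, ← ofReal_integral_eq_lintegral_ofReal hcont.integrableOn_Icc,
    integral_Icc_eq_integral_Ioc, ← intervalIntegral.integral_of_le zero_le_one,
    intervalIntegral.integral_comp_sub_mul (fun y => y ^ n) hc0.ne', integral_pow]
  · refine ENNReal.ofReal_le_ofReal ?_
    rw [smul_eq_mul, one_div, mul_inv, ← one_div ((n : ℝ) + 1)]
    gcongr
    have : 0 ≤ (1 - c * 1) ^ (n + 1) := pow_nonneg (by linarith) _
    simp only [mul_zero, sub_zero, one_pow]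
    linarith
  · filter_upwards [ae_restrict_mem measurableSet_Icc] with y hy
    exact pow_nonneg (sub_nonneg.2 (mul_le_one₀ hc1 hy.1 hy.2)) n

/-- The law of `n` independent uniform points of the unit interval. -/
noncomputable abbrev iidUnif01 (n : ℕ) : Measure (Fin n → ℝ) := Measure.pi fun _ => unif01

section Uniform

variable {ι α : Type*} [Fintype ι] [MeasurableSpace α] {n d s : ℕ}

lemma measurable_between {S : α → ι → ℝ} {u v : α → ℝ} (hS : Measurable S) (hu : Measurable u)
    (hv : Measurable v) : Measurable fun p => between (S p) (u p) (v p) := by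
  classical
  unfold between
  simp_rw [Finset.card_filter]
  refine Finset.measurable_fun_sum _ fun i _ => .ite ?_ measurable_const measurable_const
  have hSi : Measurable fun p => S p i := (measurable_pi_apply i).comp hS
  exact (measurableSet_lt (hu.min hv) hSi).inter (measurableSet_lt hSi (hu.max hv))

lemma measurableSet_separates {κ : Type*} [Countable κ] :
    MeasurableSet {p : (ι → ℝ) × (κ → ℝ) | Separates s p.1 p.2} := by
  have hle {u v : (ι → ℝ) × (κ → ℝ) → ℝ} (hu : Measurable u) (hv : Measurable v) :
      Measurable fun p => s ≤ between p.1 (u p) (v p) :=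
    measurableSet_setOfPred.1 (measurable_between measurable_fst hu hv measurableSet_Ici)
  refine measurableSet_setOfPred.2 <| .and
    (.forall fun i => .forall fun j => measurable_const.imp ?_) (.forall fun i => .and ?_ ?_) <;>
  exact hle (by fun_prop) (by fun_prop)

lemma measure_prod_between_lt_le {ν : Measure α} [SFinite ν] (hs : s ≠ 0) {u v : α → ℝ}
    (hu : Measurable u) (hv : Measurable v) (hu01 : ∀ᵐ w ∂ν, u w ∈ Set.Icc (0 : ℝ) 1)
    (hv01 : ∀ᵐ w ∂ν, v w ∈ Set.Icc (0 : ℝ) 1) :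
    (iidUnif01 n).prod ν {p | between p.1 (u p.2) (v p.2) < s} ≤
      ∫⁻ w, ENNReal.ofReal (2 * (1 - |u w - v w| / (2 * s)) ^ n) ∂ν := by
  classical
  have hmeas : MeasurableSet {p : (Fin n → ℝ) × α | between p.1 (u p.2) (v p.2) < s} :=
    measurable_between measurable_fst (hu.comp measurable_snd) (hv.comp measurable_snd)
      measurableSet_Iio
  rw [Measure.prod_apply_symm hmeas]
  refine lintegral_mono_ae ?_
  filter_upwards [hu01, hv01] with w huw hvw
  rw [← unif01_real_uIoo huw hvw]
  exact (measure_pi_card_mem_lt_le (A := Set.uIoo (u w) (v w)) measurableSet_Ioo hs).trans_eq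
    (by rw [Fintype.card_fin])

lemma lintegral_unif01_gap_le (hs : s ≠ 0) {x : ℝ} (hx : x ∈ Set.Icc (0 : ℝ) 1) :
    ∫⁻ y, ENNReal.ofReal (2 * (1 - |x - y| / (2 * s)) ^ n) ∂unif01 ≤
      ENNReal.ofReal (8 * s / (n + 1)) := by
  have hs' : (1 : ℝ) ≤ s := Nat.one_le_cast.2 (Nat.one_le_iff_ne_zero.2 hs)
  simp_rw [div_eq_inv_mul _ (2 * (s : ℝ)), ENNReal.ofReal_mul zero_le_two, ENNReal.ofReal_ofNat]
  rw [lintegral_const_mul _ (by fun_prop)]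
  calc _ ≤ 2 * (2 * ∫⁻ y, ENNReal.ofReal ((1 - (2 * (s : ℝ))⁻¹ * y) ^ n) ∂unif01) := by
        gcongr
        exact lintegral_unif01_comp_abs_sub_le hx
          fun y => ENNReal.ofReal ((1 - (2 * (s : ℝ))⁻¹ * y) ^ n)
    _ ≤ 2 * (2 * ENNReal.ofReal (1 / ((2 * (s : ℝ))⁻¹ * (n + 1)))) := by
        gcongr
        exact lintegral_unif01_one_sub_mul_pow_le (by positivity)
          (inv_le_one_of_one_le₀ (by linarith)) n
    _ = ENNReal.ofReal (8 * s / (n + 1)) := by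
        rw [← ENNReal.ofReal_ofNat 2, ← ENNReal.ofReal_mul zero_le_two,
          ← ENNReal.ofReal_mul zero_le_two]
        congr 1
        field_simp
        norm_num

lemma measure_between_point_root_lt_le (hs : s ≠ 0) {x : ℝ} (hx : x ∈ Set.Icc (0 : ℝ) 1)
    (i : Fin d) :
    (iidUnif01 n).prod (iidUnif01 d) {p | between p.1 x (p.2 i) < s} ≤
      ENNReal.ofReal (8 * s / (n + 1)) := by
  have heval := measurePreserving_eval (fun _ : Fin d => unif01) i
  refine (measure_prod_between_lt_le hs measurable_const (measurable_pi_apply i) (.of_forall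
    fun _ => hx) (heval.quasiMeasurePreserving.ae ae_unif01_mem_Icc)).trans ?_
  rw [heval.lintegral_comp (f := fun y => ENNReal.ofReal (2 * (1 - |x - y| / (2 * s)) ^ n))
    (by fun_prop)]
  exact lintegral_unif01_gap_le hs hx

lemma measure_between_roots_lt_le (hs : s ≠ 0) {i j : Fin d} (hij : i ≠ j) :
    (iidUnif01 n).prod (iidUnif01 d) {p | between p.1 (p.2 i) (p.2 j) < s} ≤
      ENNReal.ofReal (8 * s / (n + 1)) := by
  have heval k := (measurePreserving_eval (fun _ : Fin d => unif01) k).quasiMeasurePreserving.ae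
    ae_unif01_mem_Icc
  refine (measure_prod_between_lt_le hs (measurable_pi_apply i) (measurable_pi_apply j) (heval i)
    (heval j)).trans ?_
  rw [(measurePreserving_eval_pair hij).lintegral_comp
    (f := fun p => ENNReal.ofReal (2 * (1 - |p.1 - p.2| / (2 * s)) ^ n)) (by fun_prop),
    lintegral_prod _ (by fun_prop)]
  calc _ ≤ ∫⁻ _, ENNReal.ofReal (8 * s / (n + 1)) ∂unif01 := by
        refine lintegral_mono_ae ?_
        filter_upwards [ae_unif01_mem_Icc] with x hx
        exact lintegral_unif01_gap_le hs hx
    _ = _ := by rw [lintegral_const, measure_univ, mul_one]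

lemma measure_not_separates_le (hs : s ≠ 0) :
    (iidUnif01 n).prod (iidUnif01 d) {p | ¬ Separates s p.1 p.2} ≤
      ENNReal.ofReal (24 * d ^ 2 * s / (n + 1)) := by
  set P := (iidUnif01 n).prod (iidUnif01 d)
  set B := ENNReal.ofReal (8 * s / (n + 1))
  have hsub : {p : (Fin n → ℝ) × (Fin d → ℝ) | ¬ Separates s p.1 p.2} ⊆
      (⋃ ij ∈ (Finset.univ : Finset (Fin d)).offDiag, {p | between p.1 (p.2 ij.1) (p.2 ij.2) < s}) ∪
      ⋃ i ∈ (Finset.univ : Finset (Fin d)),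
        {p | between p.1 0 (p.2 i) < s} ∪ {p | between p.1 1 (p.2 i) < s} := by
    intro p hp
    simp only [Separates, Set.mem_ofPred_eq, not_and_or, not_forall, not_le, exists_prop] at hp
    simpa using hp
  calc P {p | ¬ Separates s p.1 p.2}
      ≤ (∑ _ij ∈ (Finset.univ : Finset (Fin d)).offDiag, B) + ∑ _i : Fin d, (B + B) := by
        refine (measure_mono hsub).trans <| (measure_union_le _ _).trans <| add_le_add
          ((measure_biUnion_finset_le _ _).trans <| Finset.sum_le_sum fun ij hij => ?_)
          ((measure_biUnion_finset_le _ _).trans <| Finset.sum_le_sum fun i _ =>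
            (measure_union_le _ _).trans <| add_le_add ?_ ?_)
        · exact measure_between_roots_lt_le hs (Finset.mem_offDiag.1 hij).2.2
        · exact measure_between_point_root_lt_le hs (by simp) i
        · exact measure_between_point_root_lt_le hs (by simp) i
    _ ≤ (3 * d ^ 2 : ℕ) * B := by
        simp only [Finset.sum_const, Finset.offDiag_card, Finset.card_fin, nsmul_eq_mul, ← two_mul,
          ← mul_assoc, ← add_mul]
        gcongr
        exact_mod_cast (by nlinarith [Nat.sub_le (d * d) d, Nat.le_self_pow two_ne_zero d] :
          d * d - d + d * 2 ≤ 3 * d ^ 2)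
    _ = _ := by
        rw [← ENNReal.ofReal_natCast, ← ENNReal.ofReal_mul (by positivity)]
        push_cast
        ring_nf

end Uniform

section Sample

variable {ι : Type*} {n d M : ℕ}

lemma measurableSet_hitsCells [Countable ι] : MeasurableSet {S : ι → ℝ | HitsCells M S} :=
  measurableSet_setOfPred.2 <| .forall fun _ => .forall fun _ => .exists fun i =>
    measurableSet_setOfPred.1 (measurable_pi_apply i measurableSet_Ioo)

lemma measure_not_hitsCells_le (hM : 0 < M) :
    iidUnif01 n {S | ¬ HitsCells M S} ≤ ENNReal.ofReal (M * (2 * (1 - 1 / (2 * M)) ^ n)) := by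
  classical
  have hM' : (0 : ℝ) < M := Nat.cast_pos.2 hM
  have hcell c (hc : c ∈ Finset.range M) :
      unif01.real (Set.Ioo ((c : ℝ) / M) ((c + 1) / M)) = 1 / M := by
    have hc' : (c : ℝ) + 1 ≤ M := by exact_mod_cast Finset.mem_range.1 hc
    have hle : (c : ℝ) / M ≤ (c + 1) / M := by gcongr; linarith
    rw [← Set.uIoo_of_le hle, unif01_real_uIoo, abs_of_nonpos (sub_nonpos.2 hle)]
    · ring
    · exact ⟨by positivity, (div_le_one hM').2 (by linarith)⟩
    · exact ⟨by positivity, (div_le_one hM').2 hc'⟩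
  have hunion : {S : Fin n → ℝ | ¬ HitsCells M S} = ⋃ c ∈ Finset.range M,
      {S : Fin n → ℝ | #{i | S i ∈ Set.Ioo ((c : ℝ) / M) ((c + 1) / M)} < 1} := by
    ext S
    simp [HitsCells, Finset.filter_eq_empty_iff]
  rw [hunion]
  calc _ ≤ ∑ c ∈ Finset.range M, ENNReal.ofReal (2 * (1 - 1 / (2 * M)) ^ n) := by
        refine (measure_biUnion_finset_le _ _).trans (Finset.sum_le_sum fun c hc => ?_)
        refine (measure_pi_card_mem_lt_le (μ := unif01) (ι := Fin n)
          (A := Set.Ioo ((c : ℝ) / M) ((c + 1) / M)) measurableSet_Ioo one_ne_zero).trans_eq ?_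
        rw [hcell c hc, Nat.cast_one, mul_one, div_div, mul_comm (M : ℝ), Fintype.card_fin]
    _ = _ := by
        rw [Finset.sum_const, Finset.card_range, nsmul_eq_mul, ← ENNReal.ofReal_natCast,
          ← ENNReal.ofReal_mul hM'.le]

lemma ae_roots_generic [Countable ι] (S : ι → ℝ) :
    ∀ᵐ r ∂iidUnif01 d, ∀ l, r l ∈ Set.Ioo (0 : ℝ) 1 ∧ ∀ i, r l ≠ S i := by
  have hne y : ∀ᵐ x ∂unif01, x ≠ y := measure_eq_zero_iff_ae_notMem.1 (measure_singleton y)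
  have h : ∀ᵐ x ∂unif01, x ∈ Set.Ioo (0 : ℝ) 1 ∧ ∀ i, x ≠ S i := by
    filter_upwards [ae_unif01_mem_Icc, hne 0, hne 1, ae_all_iff.2 fun i => hne (S i)]
      with x hx h0 h1 hS
    exact ⟨⟨hx.1.lt_of_ne' h0, hx.2.lt_of_ne h1⟩, hS⟩
  exact ae_all_iff.2 fun l =>
    (measurePreserving_eval (fun _ : Fin d => unif01) l).quasiMeasurePreserving.ae h

lemma measurable_rootsPTF_comp (a : ℝ) (S : ι → ℝ) :
    Measurable fun r : Fin d → ℝ => rootsPTF a r ∘ S :=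
  measurable_pi_lambda _ fun i => (measurable_pi_apply (S i)).comp (measurable_rootsPTF a)

lemma lintegral_uniformRoots [Finite ι] (a : ℝ) (S : ι → ℝ) (F : (ι → Bool) → ℝ≥0∞) :
    ∫⁻ h, F (h ∘ S) ∂uniformRoots a d = ∫⁻ r, F (rootsPTF a r ∘ S) ∂iidUnif01 d := by
  have hcomp : Measurable fun h : ℝ → Bool => h ∘ S :=
    measurable_pi_lambda _ fun i => measurable_pi_apply (S i)
  exact lintegral_map ((Measurable.of_discrete (f := F)).comp hcomp) (measurable_rootsPTF a)

end Sample

/-! ### Lower bound -/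

section LowerBound

variable {n d M k : ℕ} {a : ℝ} {S : Fin n → ℝ}

lemma measure_exists_perm_abs_sub_le (r₀ : Fin d → ℝ) {δ : ℝ} (hδ : 0 ≤ δ) :
    iidUnif01 d {r | ∃ σ : Equiv.Perm (Fin d), ∀ l, |r l - r₀ (σ l)| ≤ δ} ≤
      ENNReal.ofReal (d.factorial * (2 * δ) ^ d) := by
  have hunion : {r | ∃ σ : Equiv.Perm (Fin d), ∀ l, |r l - r₀ (σ l)| ≤ δ} =
      ⋃ σ ∈ (Finset.univ : Finset (Equiv.Perm (Fin d))),
        Set.pi Set.univ fun l => Metric.closedBall (r₀ (σ l)) δ := by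
    ext r
    simp [Real.dist_eq]
  have hbox (σ : Equiv.Perm (Fin d)) :
      iidUnif01 d (Set.pi Set.univ fun l => Metric.closedBall (r₀ (σ l)) δ) ≤
        ENNReal.ofReal ((2 * δ) ^ d) := by
    rw [Measure.pi_pi, ENNReal.ofReal_pow (by positivity)]
    refine (Finset.prod_le_prod' fun l _ => (Measure.restrict_apply_le _ _).trans_eq
      (Real.volume_closedBall _ δ)).trans_eq ?_
    rw [Finset.prod_const, Finset.card_fin]
  calc _ ≤ ∑ _σ : Equiv.Perm (Fin d), ENNReal.ofReal ((2 * δ) ^ d) := by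
        rw [hunion]
        exact (measure_biUnion_finset_le _ _).trans (Finset.sum_le_sum fun σ _ => hbox σ)
    _ = _ := by
        rw [Finset.sum_const, Finset.card_univ, Fintype.card_perm, Fintype.card_fin, nsmul_eq_mul,
          ← ENNReal.ofReal_natCast, ← ENNReal.ofReal_mul (by positivity)]

lemma measure_separates_label_eq_le (ha : a ≠ 0) (hM : 0 < M) (hS : HitsCells M S)
    (l : Fin n → Bool) :
    iidUnif01 d {r | Separates 1 S r ∧ rootsPTF a r ∘ S = l} ≤
      ENNReal.ofReal (d.factorial * (4 / M) ^ d) := by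
  set E := {r : Fin d → ℝ | Separates 1 S r ∧ rootsPTF a r ∘ S = l}
  set G := {r : Fin d → ℝ | ∀ l, r l ∈ Set.Ioo (0 : ℝ) 1 ∧ ∀ i, r l ≠ S i}
  have hEG : iidUnif01 d E ≤ iidUnif01 d (E ∩ G) :=
    measure_mono_ae <| (ae_roots_generic S).mono fun r hr h => ⟨h, hr⟩
  refine hEG.trans ?_
  rcases (E ∩ G).eq_empty_or_nonempty with h | ⟨r₀, ⟨-, hl₀⟩, hG₀⟩
  · rw [h, measure_empty]
    exact zero_le
  have hsub : E ∩ G ⊆ {r | ∃ σ : Equiv.Perm (Fin d), ∀ l, |r l - r₀ (σ l)| ≤ 2 / M} :=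
    fun r ⟨⟨hsep, hl⟩, hr⟩ => exists_perm_abs_sub_le ha hM hS (fun l => (hr l).1)
      (fun l => (hG₀ l).1) (fun l => (hr l).2) (fun l => (hG₀ l).2) hsep (hl.trans hl₀.symm)
  refine (measure_mono hsub).trans <|
    (measure_exists_perm_abs_sub_le r₀ (by positivity)).trans_eq ?_
  congr 3
  ring

lemma measure_separates_queries_le (ha : a ≠ 0) (hM : 0 < M) (hS : HitsCells M S)
    {t : QueryTree n} (ht : ∀ r : Fin d → ℝ, t.run (rootsPTF a r ∘ S) = rootsPTF a r ∘ S) :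
    iidUnif01 d {r | Separates 1 S r ∧ t.queries (rootsPTF a r ∘ S) ≤ k} ≤
      ENNReal.ofReal (2 ^ k * (d.factorial * (4 / M) ^ d)) := by
  set T : Finset (Fin n → Bool) := {l | t.run l = l ∧ t.queries l ≤ k}
  have hsub : {r : Fin d → ℝ | Separates 1 S r ∧ t.queries (rootsPTF a r ∘ S) ≤ k} ⊆
      ⋃ l ∈ T, {r | Separates 1 S r ∧ rootsPTF a r ∘ S = l} := fun r ⟨hsep, hq⟩ =>
    Set.mem_biUnion (Finset.mem_filter.2 ⟨Finset.mem_univ _, ht r, hq⟩) ⟨hsep, rfl⟩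
  calc _ ≤ ∑ _l ∈ T, ENNReal.ofReal (d.factorial * (4 / M) ^ d) :=
        (measure_mono hsub).trans <| (measure_biUnion_finset_le _ _).trans <|
          Finset.sum_le_sum fun l _ => measure_separates_label_eq_le ha hM hS l
    _ ≤ 2 ^ k * ENNReal.ofReal (d.factorial * (4 / M) ^ d) := by
        rw [Finset.sum_const, nsmul_eq_mul]
        gcongr
        exact_mod_cast t.card_run_eq_le k
    _ = _ := by
        rw [ENNReal.ofReal_mul (p := 2 ^ k) (by positivity), ENNReal.ofReal_pow zero_le_two,
          ENNReal.ofReal_ofNat]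

lemma natCast_le_lintegral_queries (ha : a ≠ 0) (hM : 0 < M) (hS : HitsCells M S)
    {t : QueryTree n} (ht : ∀ r : Fin d → ℝ, t.run (rootsPTF a r ∘ S) = rootsPTF a r ∘ S) :
    (k : ℝ≥0∞) ≤ k * (ENNReal.ofReal (2 ^ k * (d.factorial * (4 / M) ^ d)) +
        iidUnif01 d {r | ¬ Separates 1 S r}) +
      ∫⁻ r, t.queries (rootsPTF a r ∘ S) ∂iidUnif01 d := by
  set Q : (Fin d → ℝ) → ℝ≥0∞ := fun r => t.queries (rootsPTF a r ∘ S)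
  have hQ : Measurable Q := (Measurable.of_discrete (f := fun l => (t.queries l : ℝ≥0∞))).comp
    (measurable_rootsPTF_comp a S)
  have hcover : Set.univ ⊆ {r | Separates 1 S r ∧ t.queries (rootsPTF a r ∘ S) ≤ k} ∪
      {r | ¬ Separates 1 S r} ∪ {r | (k : ℝ≥0∞) ≤ Q r} := by
    intro r _
    simp only [Q, Set.mem_union, Set.mem_ofPred_eq, Nat.cast_le]
    by_cases Separates 1 S r <;> simp [*, le_total]
  calc (k : ℝ≥0∞) = k * iidUnif01 d Set.univ := by rw [measure_univ, mul_one]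
    _ ≤ k * (iidUnif01 d {r | Separates 1 S r ∧ t.queries (rootsPTF a r ∘ S) ≤ k} +
          iidUnif01 d {r | ¬ Separates 1 S r} + iidUnif01 d {r | (k : ℝ≥0∞) ≤ Q r}) := by
        gcongr
        refine (measure_mono hcover).trans <| (measure_union_le _ _).trans ?_
        gcongr
        exact measure_union_le _ _
    _ ≤ _ := by
        rw [mul_add]
        gcongr
        · exact measure_separates_queries_le ha hM hS ht
        · exact mul_meas_ge_le_lintegral hQ _

lemma lintegral_lintegral_queries_comm (a : ℝ) (S : Fin n → ℝ) (τ : Measure (QueryTree n))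
    [SFinite τ] :
    ∫⁻ h, ∫⁻ t, t.queries (h ∘ S) ∂τ ∂uniformRoots a d =
      ∫⁻ t, ∫⁻ r, t.queries (rootsPTF a r ∘ S) ∂iidUnif01 d ∂τ := by
  have hmeas : Measurable fun p : (Fin n → Bool) × QueryTree n => (p.2.queries p.1 : ℝ≥0∞) :=
    measurable_from_prod_countable_right fun l => measurable_from_top
  rw [lintegral_uniformRoots a S fun l => ∫⁻ t, t.queries l ∂τ]
  refine lintegral_lintegral_swap (Measurable.aemeasurable ?_)
  exact hmeas.comp (((measurable_rootsPTF_comp a S).comp measurable_fst).prodMk measurable_snd)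

lemma natCast_le_lintegral_lintegral_queries (ha : a ≠ 0) (hM : 0 < M) (hS : HitsCells M S)
    {τ : Measure (QueryTree n)} [IsProbabilityMeasure τ]
    (hτ : ∀ r : Fin d → ℝ, ∀ᵐ t ∂τ, t.run (rootsPTF a r ∘ S) = rootsPTF a r ∘ S) :
    (k : ℝ≥0∞) ≤ k * (ENNReal.ofReal (2 ^ k * (d.factorial * (4 / M) ^ d)) +
        iidUnif01 d {r | ¬ Separates 1 S r}) +
      ∫⁻ h, ∫⁻ t, t.queries (h ∘ S) ∂τ ∂uniformRoots a d := by
  have hcorrect : ∀ᵐ t ∂τ, ∀ l ∈ Set.range fun r : Fin d → ℝ => rootsPTF a r ∘ S, t.run l = l :=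
    (ae_ball_iff (Set.to_countable _)).2 (Set.forall_mem_range.2 hτ)
  rw [lintegral_lintegral_queries_comm]
  calc (k : ℝ≥0∞) = ∫⁻ _t, k ∂τ := by rw [lintegral_const, measure_univ, mul_one]
    _ ≤ ∫⁻ t, (k * (ENNReal.ofReal (2 ^ k * (d.factorial * (4 / M) ^ d)) +
          iidUnif01 d {r | ¬ Separates 1 S r}) +
        ∫⁻ r, t.queries (rootsPTF a r ∘ S) ∂iidUnif01 d) ∂τ :=
      lintegral_mono_ae <| hcorrect.mono fun t ht =>
        natCast_le_lintegral_queries ha hM hS (Set.forall_mem_range.1 ht)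
    _ = _ := by rw [lintegral_add_left measurable_const, lintegral_const, measure_univ, mul_one]

theorem natCast_le_expected_queries (k : ℕ) (ha : a ≠ 0) (hM : 0 < M) {H : Set (ℝ → Bool)}
    (hH : ∀ r : Fin d → ℝ, rootsPTF a r ∈ H) {q : ℕ → ℝ≥0}
    (hq : PerfectlyLearnable unif01 (uniformRoots a d) H q) :
    (k : ℝ≥0∞) ≤ k * (ENNReal.ofReal (2 ^ k * (d.factorial * (4 / M) ^ d)) +
      (ENNReal.ofReal (24 * d ^ 2 / (n + 1)) +
        ENNReal.ofReal (M * (2 * (1 - 1 / (2 * M)) ^ n)))) + q n := by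
  obtain ⟨A, hA, hcorrect, hcost⟩ := hq
  have := hA n
  set β := ENNReal.ofReal (2 ^ k * (d.factorial * (4 / (M : ℝ)) ^ d))
  set δ : (Fin n → ℝ) → ℝ≥0∞ := fun S => iidUnif01 d {r | ¬ Separates 1 S r}
  set B : Set (Fin n → ℝ) := {S | ¬ HitsCells M S}
  have hB : MeasurableSet B := measurableSet_hitsCells.compl
  have hδ : Measurable δ := measurable_measure_prodMk_left measurableSet_separates.compl
  have hδint : ∫⁻ S, δ S ∂iidUnif01 n ≤ ENNReal.ofReal (24 * d ^ 2 / (n + 1)) := by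
    refine (Measure.prod_apply measurableSet_separates.compl).symm.trans_le ?_
    simpa using! measure_not_separates_le (n := n) (d := d) one_ne_zero
  have hsum : Measurable fun S => β + (δ S + B.indicator 1 S) :=
    (hδ.add (measurable_one.indicator hB)).const_add β
  have hpoint : ∀ᵐ S ∂iidUnif01 n, (k : ℝ≥0∞) ≤ k * (β + (δ S + B.indicator 1 S)) +
      ∫⁻ h, ∫⁻ t, t.queries (h ∘ S) ∂A n S ∂uniformRoots a d := by
    filter_upwards [ae_injective_pi] with S hinj
    by_cases hS : HitsCells M S
    · rw [Set.indicator_of_notMem (not_not.2 hS), add_zero]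
      exact natCast_le_lintegral_lintegral_queries ha hM hS fun r => hcorrect n S hinj _ (hH r)
    · rw [Set.indicator_of_mem (show S ∈ B from hS), Pi.one_apply]
      exact (le_mul_of_one_le_right' (le_add_self.trans le_add_self)).trans le_self_add
  calc (k : ℝ≥0∞) = ∫⁻ _S, k ∂iidUnif01 n := by rw [lintegral_const, measure_univ, mul_one]
    _ ≤ _ := lintegral_mono_ae hpoint
    _ = k * (β + (∫⁻ S, δ S ∂iidUnif01 n + iidUnif01 n B)) +
      ∫⁻ S, ∫⁻ h, ∫⁻ t, t.queries (h ∘ S) ∂A n S ∂uniformRoots a d ∂iidUnif01 n := by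
        rw [lintegral_add_left (hsum.const_mul _), lintegral_const_mul _ hsum,
          lintegral_add_left measurable_const, lintegral_add_left hδ, lintegral_const,
          measure_univ, mul_one, lintegral_indicator_one hB]
    _ ≤ _ := by
        gcongr
        · exact measure_not_hitsCells_le hM
        · exact hcost n

lemma pow_six_mul_one_sub_pow_le {y : ℝ} (hy : 1024 ≤ y) (hn : y ^ 8 ≤ n) :
    y ^ 6 * (2 * (1 - 1 / (2 * y ^ 6)) ^ n) ≤ 1 / 8 := by
  have : 0 < y := by linarith
  have hbase : 0 ≤ 1 - 1 / (2 * y ^ 6) := by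
    have : (1 : ℝ) ≤ y ^ 6 := one_le_pow₀ (by linarith)
    rw [sub_nonneg, div_le_one (by positivity)]
    linarith
  have hpow : (1 - 1 / (2 * y ^ 6)) ^ n ≤ Real.exp (-(y ^ 2 / 2)) := by
    refine (pow_le_pow_left₀ hbase (Real.one_sub_le_exp_neg _) n).trans ?_
    rw [← Real.exp_nat_mul, Real.exp_le_exp, mul_neg, neg_le_neg_iff]
    calc y ^ 2 / 2 = y ^ 8 * (1 / (2 * y ^ 6)) := by field_simp
      _ ≤ n * (1 / (2 * y ^ 6)) := by gcongr
  have hexp : y ^ 8 / 384 ≤ Real.exp (y ^ 2 / 2) := by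
    have := Real.pow_div_factorial_le_exp (y ^ 2 / 2) (by positivity) 4
    refine le_trans (le_of_eq ?_) this
    norm_num [Nat.factorial]
    ring
  calc y ^ 6 * (2 * (1 - 1 / (2 * y ^ 6)) ^ n) ≤ y ^ 6 * (2 * (y ^ 8 / 384)⁻¹) := by
        gcongr
        rw [Real.exp_neg] at hpow
        exact hpow.trans (inv_anti₀ (by positivity) hexp)
    _ = 768 / y ^ 2 := by field_simp; norm_num
    _ ≤ 1 / 8 := by
        rw [div_le_div_iff₀ (by positivity) (by norm_num)]
        nlinarith

lemma pow_mul_factorial_mul_le (hd : 1 ≤ d) {y : ℝ} (hy : 1 ≤ y) (hdy : d * 2 ^ 36 ≤ y ^ 4) :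
    y ^ d * (d.factorial * (4 / y ^ 6) ^ d) ≤ 1 / 8 := by
  have hfac : (d.factorial : ℝ) ≤ (d : ℝ) ^ d := by exact_mod_cast Nat.factorial_le_pow d
  have hy4 : y ^ 4 ≤ y ^ 5 := pow_le_pow_right₀ hy (by norm_num)
  calc y ^ d * (d.factorial * (4 / y ^ 6) ^ d)
      ≤ y ^ d * ((d : ℝ) ^ d * (4 / y ^ 6) ^ d) := by gcongr
    _ = (4 * d / y ^ 5) ^ d := by
        rw [← mul_pow, ← mul_pow]
        congr 1
        field_simp
    _ ≤ (1 / 8) ^ d := by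
        refine pow_le_pow_left₀ (by positivity) ?_ d
        rw [div_le_div_iff₀ (by positivity) (by norm_num)]
        have : (0 : ℝ) ≤ d := d.cast_nonneg
        linarith
    _ ≤ 1 / 8 := pow_le_of_le_one (by norm_num) (by norm_num) (by omega)

lemma half_mul_le_expected_queries (hd : 1 ≤ d) (ha : a ≠ 0) {H : Set (ℝ → Bool)}
    (hH : ∀ r : Fin d → ℝ, rootsPTF a r ∈ H) {q : ℕ → ℝ≥0}
    (hq : PerfectlyLearnable unif01 (uniformRoots a d) H q) {γ : ℕ} (hγ : 10 ≤ γ)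
    (hn : ((2 : ℝ) ^ γ) ^ 8 ≤ n) (hdγ : d * 2 ^ 36 ≤ ((2 : ℝ) ^ γ) ^ 4) :
    1 / 2 * (γ * d) ≤ (q n : ℝ) := by
  set y : ℝ := 2 ^ γ with hy
  have hy1024 : 1024 ≤ y :=
    (by norm_num : (1024 : ℝ) = 2 ^ 10).trans_le (pow_le_pow_right₀ one_le_two hγ)
  have hM : ((2 ^ (6 * γ) : ℕ) : ℝ) = y ^ 6 := by rw [hy, ← pow_mul, mul_comm γ]; norm_cast
  have hseparate : 24 * (d : ℝ) ^ 2 / (n + 1) ≤ 1 / 8 := by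
    rw [div_le_div_iff₀ (by positivity) (by norm_num)]
    nlinarith
  have hmain := natCast_le_expected_queries (n := n) (M := 2 ^ (6 * γ)) (γ * d) ha (by positivity)
    hH hq
  rw [hM, pow_mul, ← hy] at hmain
  have hquery : ((γ * d : ℕ) : ℝ≥0∞) ≤
      ENNReal.ofReal ((γ * d : ℕ) * (1 / 8 + (1 / 8 + 1 / 8)) + q n) := by
    refine hmain.trans ?_
    rw [ENNReal.ofReal_add (by positivity) (by positivity),
      ENNReal.ofReal_mul (p := (γ * d : ℕ)) (by positivity),
      ENNReal.ofReal_add (by norm_num) (by norm_num),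
      ENNReal.ofReal_add (by norm_num) (by norm_num), ENNReal.ofReal_natCast,
      ENNReal.ofReal_coe_nnreal]
    gcongr
    · exact pow_mul_factorial_mul_le hd (by linarith) hdγ
    · exact pow_six_mul_one_sub_pow_le hy1024 hn
  rw [← ENNReal.ofReal_natCast, ENNReal.ofReal_le_ofReal_iff (by positivity)] at hquery
  push_cast at hquery
  have : (0 : ℝ) ≤ γ * d := by positivity
  linarith

theorem mul_log_le_expected_queries (hd : 1 ≤ d) (ha : a ≠ 0) {H : Set (ℝ → Bool)}
    (hH : ∀ r : Fin d → ℝ, rootsPTF a r ∈ H) {q : ℕ → ℝ≥0}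
    (hq : PerfectlyLearnable unif01 (uniformRoots a d) H q)
    (hn : (2 : ℝ) ^ 88 * d ^ 2 ≤ n) : 1 / 32 * d * Real.log n ≤ q n := by
  have hd' : (1 : ℝ) ≤ d := Nat.one_le_cast.2 hd
  have hn88 : (2 : ℝ) ^ 88 ≤ n := by nlinarith
  have hn0 : n ≠ 0 := by rintro rfl; norm_num at hn88
  have hlog : 88 ≤ Nat.log 2 n := (Nat.le_log_iff_pow_le one_lt_two hn0).2 (by exact_mod_cast hn88)
  set γ := Nat.log 2 n / 8
  have hγ : 10 ≤ γ := by omega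
  have hlow : ((2 : ℝ) ^ γ) ^ 8 ≤ n := by
    rw [← pow_mul]
    exact_mod_cast Nat.pow_le_of_le_log hn0 (by omega)
  have hupp : (n : ℝ) ≤ (2 ^ γ) ^ 8 * 2 ^ 8 := by
    rw [← pow_mul, ← pow_add]
    exact_mod_cast (Nat.lt_pow_of_log_lt one_lt_two (by omega)).le
  have hdγ : d * 2 ^ 36 ≤ ((2 : ℝ) ^ γ) ^ 4 := by
    refine le_of_sq_le_sq ?_ (by positivity)
    nlinarith
  have hloglog : Real.log n ≤ 16 * γ := by
    have hmono := Real.log_le_log (by positivity) hupp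
    rw [← pow_mul, ← pow_add, Real.log_pow] at hmono
    have : (10 : ℝ) ≤ γ := by exact_mod_cast hγ
    have := Real.log_two_lt_d9
    push_cast at hmono
    nlinarith
  calc 1 / 32 * d * Real.log n ≤ 1 / 32 * d * (16 * γ) := by gcongr
    _ = 1 / 2 * (γ * d) := by ring
    _ ≤ q n := half_mul_le_expected_queries hd ha hH hq hγ hlow hdγ

end LowerBound

/-! ### Upper bound -/

section Sorting

variable {α β : Type*} [LinearOrder α] {m n : ℕ}

lemma measurable_comp_sort [TopologicalSpace α] [OrderClosedTopology α]
    [SecondCountableTopology α] [MeasurableSpace α] [OpensMeasurableSpace α] [MeasurableSpace β]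
    (g : Equiv.Perm (Fin n) → β) : Measurable fun S : Fin n → α => g (Tuple.sort S) := by
  have hsort (σ : Equiv.Perm (Fin n)) : MeasurableSet {S : Fin n → α | Tuple.sort S = σ} := by
    simp_rw [eq_comm (b := σ), Tuple.eq_sort_iff, Monotone]
    refine measurableSet_setOfPred.2 <| .and
      (.forall fun i => .forall fun j => measurable_const.imp ?_)
      (.forall fun i => .forall fun j => measurable_const.imp <| .imp ?_ measurable_const)
    · exact measurableSet_setOfPred.1 <|
        measurableSet_le (measurable_pi_apply (σ i)) (measurable_pi_apply (σ j))
    · exact measurableSet_setOfPred.1 <|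
        measurableSet_eq_fun (measurable_pi_apply (σ i)) (measurable_pi_apply (σ j))
  intro s _
  have hpreimage : (fun S : Fin n → α => g (Tuple.sort S)) ⁻¹' s =
      ⋃ σ ∈ g ⁻¹' s, {S | Tuple.sort S = σ} := by
    ext S
    simp
  rw [hpreimage]
  exact .biUnion (Set.to_countable _) fun σ _ => hsort σ

/-- The index of the point at position `k` of the sample sorted by `σ`. Positions beyond the end
stand for the last one, so that the sorted sample is a monotone sequence on `ℕ`. -/
def sortedIndex (σ : Equiv.Perm (Fin (m + 1))) (k : ℕ) : Fin (m + 1) := σ (Fin.clamp k m)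

lemma sortedIndex_symm (σ : Equiv.Perm (Fin (m + 1))) (i : Fin (m + 1)) :
    sortedIndex σ (σ.symm i) = i := by
  have hclamp : Fin.clamp (σ.symm i) m = σ.symm i :=
    Fin.ext (min_eq_left (Nat.le_of_lt_succ (σ.symm i).isLt))
  rw [sortedIndex, hclamp, Equiv.apply_symm_apply]

lemma monotone_comp_sortedIndex (S : Fin (m + 1) → α) :
    Monotone fun k => S (sortedIndex (Tuple.sort S) k) :=
  (Tuple.monotone_sort S).comp Fin.clamp_monotone

lemma lt_sort_symm {S : Fin (m + 1) → α} {i : Fin (m + 1)} {k : ℕ}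
    (h : S (sortedIndex (Tuple.sort S) k) < S i) : k < (Tuple.sort S).symm i := by
  by_contra! hle
  have hmono := monotone_comp_sortedIndex S hle
  simp only [sortedIndex_symm] at hmono
  exact hmono.not_gt h

lemma sort_symm_lt {S : Fin (m + 1) → α} {i : Fin (m + 1)} {k : ℕ}
    (h : S i < S (sortedIndex (Tuple.sort S) k)) : (Tuple.sort S).symm i < k := by
  by_contra! hle
  have hmono := monotone_comp_sortedIndex S hle
  simp only [sortedIndex_symm] at hmono
  exact hmono.not_gt h

end Sorting

section UpperBound

variable {m n d s k : ℕ} {a : ℝ}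

lemma between_lt_of_mem_Icc {S : Fin (m + 1) → ℝ} (hs : 0 < s) {u v : ℝ}
    (hu : u ∈ Set.Icc (S (sortedIndex (Tuple.sort S) k)) (S (sortedIndex (Tuple.sort S) (k + s))))
    (hv : v ∈ Set.Icc (S (sortedIndex (Tuple.sort S) k)) (S (sortedIndex (Tuple.sort S) (k + s)))) :
    between S u v < s := by
  classical
  calc between S u v ≤ #(Finset.Ioo k (k + s)) := by
        refine Finset.card_le_card_of_injOn (fun i => ((Tuple.sort S).symm i : ℕ)) (fun i hi => ?_)
          (Fin.val_injective.comp (Tuple.sort S).symm.injective).injOn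
        obtain ⟨hlow, hupp⟩ := (Finset.mem_filter.1 hi).2
        exact Finset.mem_coe.2 <| Finset.mem_Ioo.2
          ⟨lt_sort_symm ((le_inf hu.1 hv.1).trans_lt hlow),
            sort_symm_lt (hupp.trans_le (sup_le hu.2 hv.2))⟩
    _ < s := by rw [Nat.card_Ioo]; omega

lemma changes_sorted_le {h : ℝ → Bool} (hh : h ∈ PTF d) (S : Fin (m + 1) → ℝ) (s k : ℕ) :
    changes (fun j => (h ∘ S) (sortedIndex (Tuple.sort S) (j * s))) k ≤ d :=
  changes_le_of_mem_PTF hh (x := fun j => S (sortedIndex (Tuple.sort S) (j * s)))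
    (fun _ _ hij => monotone_comp_sortedIndex S (Nat.mul_le_mul_right s hij)) k

lemma le_changes_of_separates (ha : a ≠ 0) {S : Fin (m + 1) → ℝ} {r : Fin d → ℝ}
    (hr : ∀ l, r l ∈ Set.Ioo (0 : ℝ) 1 ∧ ∀ i, r l ≠ S i) (hs : 0 < s) (hk : m < k * s)
    (hsep : Separates s S r) :
    d ≤ changes (fun j => (rootsPTF a r ∘ S) (sortedIndex (Tuple.sort S) (j * s))) k := by
  have hmono := monotone_comp_sortedIndex S
  refine le_changes_rootsPTF ha (x := fun j => S (sortedIndex (Tuple.sort S) (j * s)))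
    (fun _ _ hij => hmono (Nat.mul_le_mul_right s hij)) (fun l _ => (hr l).2 _) (fun l => ?_)
    (fun l => ?_) fun i j c hi hj => ?_
  · obtain ⟨i, hi⟩ := one_le_between.1 (hs.trans_le (hsep.2 l).1)
    rw [Set.uIoo_of_le (hr l).1.1.le] at hi
    have hfirst := hmono (show 0 * s ≤ (Tuple.sort S).symm i by simp)
    simp only [sortedIndex_symm] at hfirst
    exact hfirst.trans_lt hi.2
  · obtain ⟨i, hi⟩ := one_le_between.1 (hs.trans_le (hsep.2 l).2)
    rw [Set.uIoo_of_ge (hr l).1.2.le] at hi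
    have hlast := hmono (show ((Tuple.sort S).symm i : ℕ) ≤ k * s by omega)
    simp only [sortedIndex_symm] at hlast
    exact hi.1.trans_le hlast
  · by_contra hne
    simp only [add_one_mul] at hi hj
    exact (between_lt_of_mem_Icc hs hi hj).not_ge (hsep.1 i j hne)

/-- The deterministic learner of the upper bound: dyadic refinement on the sample sorted by `σ`,
with enough levels to reach every point. -/
def sortedLearner (d : ℕ) : (n : ℕ) → Equiv.Perm (Fin n) → QueryTree n
  | 0, _ => .output fun _ => true
  | m + 1, σ => .dyadic d (sortedIndex σ) (fun i => σ.symm i) (Nat.log 2 (m + 1) + 1)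

lemma run_sortedLearner (S : Fin n → ℝ) {h : ℝ → Bool} (hh : h ∈ PTF d) :
    (sortedLearner d n (Tuple.sort S)).run (h ∘ S) = h ∘ S := by
  cases n with
  | zero => exact Subsingleton.elim _ _
  | succ m =>
    exact QueryTree.run_dyadic (sortedIndex_symm _)
      (fun i => (Fin.isLt _).le.trans (Nat.lt_pow_succ_log_self one_lt_two _).le)
      (changes_sorted_le hh S)

/-- The samples of `n` points and the roots which are not yet separated at the spacing of level `j`
of the dyadic refinement. Outside this event the refinement has seen all the changes. -/
def unseparatedAt (n d j : ℕ) : Set ((Fin n → ℝ) × (Fin d → ℝ)) :=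
  {p | ¬ Separates (2 ^ (Nat.log 2 n + 1 - j)) p.1 p.2}

lemma queries_sortedLearner_le (ha : a ≠ 0) {S : Fin n → ℝ} {r : Fin d → ℝ}
    (hr : ∀ l, r l ∈ Set.Ioo (0 : ℝ) 1 ∧ ∀ i, r l ≠ S i) :
    ((sortedLearner d n (Tuple.sort S)).queries (rootsPTF a r ∘ S) : ℝ≥0∞) ≤
      2 + ∑ j ∈ Finset.range (Nat.log 2 n + 1),
        ((d : ℝ≥0∞) + 2 ^ j * (unseparatedAt n d j).indicator 1 (S, r)) := by
  rcases n with _ | m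
  · simp [sortedLearner, QueryTree.queries]
  refine (Nat.cast_le.2 (QueryTree.queries_dyadic_le
    (changes_sorted_le (rootsPTF_mem_PTF a r) S))).trans ?_
  push_cast
  gcongr with j hj
  set s := 2 ^ (Nat.log 2 (m + 1) + 1 - j) with hs
  by_cases hsep : Separates s S r
  · rw [if_neg]
    · exact zero_le
    refine not_lt.2 <| le_changes_of_separates ha hr (by positivity) ?_ hsep
    rw [hs, ← pow_add, Nat.add_sub_cancel' (Finset.mem_range.1 hj).le]
    exact m.lt_succ_self.trans (Nat.lt_pow_succ_log_self one_lt_two _)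
  · rw [Set.indicator_of_mem (show (S, r) ∈ unseparatedAt (m + 1) d j from hsep), Pi.one_apply,
      mul_one]
    split_ifs
    exacts [le_rfl, zero_le]

lemma two_pow_mul_measure_unseparatedAt_le {j : ℕ} (hj : j ≤ Nat.log 2 n + 1) :
    2 ^ j * (iidUnif01 n).prod (iidUnif01 d) (unseparatedAt n d j) ≤ (48 * d ^ 2 : ℕ) := by
  set s := 2 ^ (Nat.log 2 n + 1 - j) with hs
  have hjs : (2 : ℝ) ^ j * s ≤ 2 * (n + 1) := by
    have hpow : 2 ^ Nat.log 2 n ≤ n + 1 := Nat.pow_log_le_add_one 2 n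
    rw [hs, Nat.cast_pow, Nat.cast_ofNat, ← pow_add, Nat.add_sub_cancel' hj, pow_succ']
    exact_mod_cast Nat.mul_le_mul_left 2 hpow
  calc _ ≤ 2 ^ j * ENNReal.ofReal (24 * d ^ 2 * s / (n + 1)) := by
        gcongr
        exact measure_not_separates_le (by positivity)
    _ = ENNReal.ofReal (24 * d ^ 2 * (2 ^ j * s) / (n + 1)) := by
        rw [← ENNReal.ofReal_ofNat, ← ENNReal.ofReal_pow zero_le_two,
          ← ENNReal.ofReal_mul (by positivity)]
        ring_nf
    _ ≤ ENNReal.ofReal (48 * d ^ 2 : ℕ) := by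
        refine ENNReal.ofReal_le_ofReal ?_
        rw [div_le_iff₀ (by positivity)]
        push_cast
        nlinarith [sq_nonneg (d : ℝ)]
    _ = _ := ENNReal.ofReal_natCast _

lemma lintegral_queries_sortedLearner_le (ha : a ≠ 0) :
    ∫⁻ S, ∫⁻ r, (sortedLearner d n (Tuple.sort S)).queries (rootsPTF a r ∘ S)
      ∂iidUnif01 d ∂iidUnif01 n ≤ (2 + (Nat.log 2 n + 1) * (49 * d ^ 2) : ℕ) := by
  have hbad j : MeasurableSet (unseparatedAt n d j) := measurableSet_separates.compl
  have hmeas j : Measurable fun p : (Fin n → ℝ) × (Fin d → ℝ) =>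
      (2 : ℝ≥0∞) ^ j * (unseparatedAt n d j).indicator 1 p :=
    (measurable_one.indicator (hbad j)).const_mul _
  calc _ ≤ ∫⁻ S, ∫⁻ r, (2 + ∑ j ∈ Finset.range (Nat.log 2 n + 1),
          ((d : ℝ≥0∞) + 2 ^ j * (unseparatedAt n d j).indicator 1 (S, r)))
            ∂iidUnif01 d ∂iidUnif01 n :=
        lintegral_mono fun S => lintegral_mono_ae <|
          (ae_roots_generic S).mono fun r hr => queries_sortedLearner_le ha hr
    _ = 2 + ∑ j ∈ Finset.range (Nat.log 2 n + 1),
          ((d : ℝ≥0∞) + 2 ^ j * (iidUnif01 n).prod (iidUnif01 d) (unseparatedAt n d j)) := by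
        rw [← lintegral_prod (fun p => 2 + ∑ j ∈ Finset.range (Nat.log 2 n + 1),
          ((d : ℝ≥0∞) + 2 ^ j * (unseparatedAt n d j).indicator 1 p))
          ((Finset.measurable_fun_sum _ fun j _ =>
            (hmeas j).const_add _).const_add _).aemeasurable,
          lintegral_add_left measurable_const,
          lintegral_finsetSum _ fun j _ => (hmeas j).const_add _]
        simp only [lintegral_add_left measurable_const, lintegral_const, measure_univ, mul_one,
          lintegral_const_mul _ (measurable_one.indicator (hbad _)),
          lintegral_indicator_one (hbad _)]
    _ ≤ 2 + ∑ _j ∈ Finset.range (Nat.log 2 n + 1), ((49 * d ^ 2 : ℕ) : ℝ≥0∞) := by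
        gcongr with j hj
        refine (add_le_add_right (two_pow_mul_measure_unseparatedAt_le
          (Finset.mem_range.1 hj).le) _).trans ?_
        exact_mod_cast (by nlinarith [Nat.le_self_pow two_ne_zero d] :
          d + 48 * d ^ 2 ≤ 49 * d ^ 2)
    _ = _ := by
        rw [Finset.sum_const, Finset.card_range, nsmul_eq_mul]
        push_cast
        rfl

theorem perfectlyLearnable_uniformRoots (ha : a ≠ 0) (d : ℕ) :
    PerfectlyLearnable unif01 (uniformRoots a d) (PTF d)
      fun n => (2 + (Nat.log 2 n + 1) * (49 * d ^ 2) : ℕ) := by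
  refine ⟨fun n => Kernel.deterministic (fun S => sortedLearner d n (Tuple.sort S))
    (measurable_comp_sort _), fun n => inferInstance, fun n S _ h hh => ?_, fun n => ?_⟩
  · rw [Kernel.deterministic_apply, ae_dirac_iff MeasurableSpace.measurableSet_top]
    exact run_sortedLearner S hh
  · simp_rw [Kernel.deterministic_apply, lintegral_dirac' _ measurable_from_top]
    have hroots (S : Fin n → ℝ) := lintegral_uniformRoots (d := d) a S
      fun l => ((sortedLearner d n (Tuple.sort S)).queries l : ℝ≥0∞)
    simp_rw [hroots]
    exact_mod_cast lintegral_queries_sortedLearner_le ha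

lemma two_add_natLog_mul_sq_le (hd : 1 ≤ d) (hn : 2 ≤ n) :
    ((2 + (Nat.log 2 n + 1) * (49 * d ^ 2) : ℕ) : ℝ) ≤ 200 * d ^ 2 * Real.log n := by
  have hd2 : (1 : ℝ) ≤ d ^ 2 := one_le_pow₀ (Nat.one_le_cast.2 hd)
  have hnatlog : (Nat.log 2 n : ℝ) * Real.log 2 ≤ Real.log n := by
    rw [← Real.log_pow]
    exact Real.log_le_log (by positivity) (by exact_mod_cast Nat.pow_log_le_self 2 (by omega))
  have hlog2 := Real.log_two_gt_d9
  have hlogn : Real.log 2 ≤ Real.log n := Real.log_le_log two_pos (by exact_mod_cast hn)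
  have hnat : (Nat.log 2 n : ℝ) ≤ 3 / 2 * Real.log n := by
    have : (0 : ℝ) ≤ Nat.log 2 n := Nat.cast_nonneg _
    nlinarith
  push_cast
  calc 2 + ((Nat.log 2 n : ℝ) + 1) * (49 * d ^ 2)
      ≤ 2 * d ^ 2 + (3 / 2 * Real.log n + 1) * (49 * d ^ 2) := by gcongr; linarith
    _ = (51 + 147 / 2 * Real.log n) * d ^ 2 := by ring
    _ ≤ 200 * Real.log n * d ^ 2 := by gcongr; linarith
    _ = 200 * d ^ 2 * Real.log n := by ring

end UpperBound

/-! ### The two bounds -/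

lemma one_le_two_mul_log_max_two (x : ℝ) : 1 ≤ 2 * Real.log (max x 2) := by
  have := Real.log_two_gt_d9
  have := Real.log_le_log two_pos (le_max_right x 2)
  linarith

theorem mainTheorem6_general :
    ∃ c C K : ℝ, 0 < c ∧ 0 < C ∧ 0 < K ∧
      ∀ d : ℕ, 1 ≤ d → ∀ a : ℝ, a ≠ 0 →
        (∃ q : ℕ → ℝ≥0, PerfectlyLearnable unif01 (uniformRoots a d) (PTF d) q ∧
          ∀ n : ℕ, 2 ≤ n → (q n : ℝ) ≤ C * (d : ℝ) ^ 2 * Real.log n) ∧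
        (∀ H : Set (ℝ → Bool), (∀ r : Fin d → ℝ, rootsPTF a r ∈ H) →
          ∀ q : ℕ → ℝ≥0, PerfectlyLearnable unif01 (uniformRoots a d) H q →
            ∀ n : ℕ, K * (d : ℝ) ^ 2 ≤ n → c * d * Real.log n ≤ q n) := by
  refine ⟨1 / 32, 200, 2 ^ 88, by norm_num, by norm_num, by norm_num, fun d hd a ha =>
    ⟨⟨_, perfectlyLearnable_uniformRoots ha d, fun n hn => ?_⟩, fun H hH q hq n hn => ?_⟩⟩
  · exact two_add_natLog_mul_sq_le hd hn
  · exact mul_log_le_expected_queries hd ha hH hq hn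

theorem mainTheorem6 :
    ∃ c C K : ℝ, 0 < c ∧ 0 < C ∧ 0 < K ∧
      ∀ d : ℕ, 1 ≤ d → ∀ a : ℝ, a ≠ 0 →
        (∃ q : ℕ → ℝ≥0, PerfectlyLearnable unif01 (uniformRoots a d) (PTF d) q ∧
          ∀ n : ℕ, 2 ≤ n →
            (q n : ℝ) ≤ C * (d : ℝ) ^ 2 * Real.log (max (d : ℝ) 2) * Real.log n) ∧
        (∀ q : ℕ → ℝ≥0, PerfectlyLearnable unif01 (uniformRoots a d) (PTF d) q →
          ∀ n : ℕ, K * (d : ℝ) ^ 2 ≤ n → c * d * Real.log n ≤ q n) := by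
  obtain ⟨c, C, K, hc, hC, hK, h⟩ := mainTheorem6_general
  refine ⟨c, C * 2, K, hc, by positivity, hK, fun d hd a ha => ?_⟩
  obtain ⟨⟨q, hq, hqC⟩, hlower⟩ := h d hd a ha
  refine ⟨⟨q, hq, fun n hn => (hqC n hn).trans ?_⟩, hlower _ (rootsPTF_mem_PTF a)⟩
  calc C * (d : ℝ) ^ 2 * Real.log n
      ≤ C * (d : ℝ) ^ 2 * Real.log n * (2 * Real.log (max d 2)) :=
        le_mul_of_one_le_right (by positivity) (one_le_two_mul_log_max_two d)
    _ = C * 2 * (d : ℝ) ^ 2 * Real.log (max d 2) * Real.log n := by ring
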